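/- Let $q$ be a prime power, let $0\le k\le n$, and let $W^n$ be an $n$-dimensional vector space over $\mathrm{GF}(q)$ with a fixed complete flag $W^0\subset W^1\subset\dots\subset W^n$, $\dim W^m=m$. Write $[m]_q=1+q+\dots+q^{m-1}$, $[m]_q!=[m]_q[m-1]_q\cdots[1]_q$ and $\begin{bmatrix}m\\ r\end{bmatrix}_q=\frac{[m]_q!}{[r]_q!\,[m-r]_q!}$. An $(m,k;q)$-Grassmannian Gray code is a sequence of distinct $k$-dimensional subspaces of $W^m$ such that any two consecutive ones intersect in dimension $k-1$. For a subspace $U$ and a vector $v$ let $[v]_U=\{\alpha v+w:\alpha\in\mathrm{GF}(q)\setminus\{0\},\,w\in U\}$. The following recursive construction produces $(m,k;q)$-Grassmannian Gray codes. (a) For $k=0$ and for $k=m$ it produces the one-entry codes $\{0\}$ and $W^m$, respectively. (b) For $0<k<m$, take an $(m-1,k;q)$-code $C'_0,\dots,C'_{P'-1}$ and an $(m-1,k-1;q)$-code $C''_0,\dots,C''_{P''-1}$, both in $W^{m-1}$ and both produced by the construction, and put $Q=q^{m-k}$. For each $s$ list representatives $v_{s,0},\dots,v_{s,Q-1}$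 of all the classes $[v]_{C''_s}$ of vectors $v\in W^m\setminus W^{m-1}$, one of each, so that $[v_{s,Q-1}]_{C''_s}\cap[v_{s+1,0}]_{C''_{s+1}}\neq\emptyset$ for $0\le s\le P''-1$, with $s+1$ taken modulo $P''$ (no such condition if $P''=1$). Let $C^*_{sQ+a}=C''_s\oplus\langle v_{s,a}\rangle$ for $0\le s<P''$, $0\le a<Q$. Choose $0\le j\le P'-1$, let $i$ be the index with $C''_i=C'_j\cap C'_{j+1}$ (indices of $C'$ modulo $P'$; if $P'=1$, then $i$ is arbitrary), choose $0\le\ell\le Q-2$, and output $$C^*_0,\dots,C^*_{iQ+\ell},\;C'_{j+1},\dots,C'_{P'-1},C'_0,\dots,C'_j,\;C^*_{iQ+\ell+1},\dots,C^*_{P''Q-1}.$$ Let $T(m,k)$ be the number of distinct $(m,k;q)$-Grassmannian Gray codes produced in this way, where cyclic shifts of a code count as distinct codes. **Theorem.** For $0\le k\le n$, $$T(n,k)\;\ge\;\prod_{i=1}^{n-k}\prod_{j=1}^{k}\left((q-1)q^{i-1}\bigl((q^i-1)!\,q\bigr)^{\begin{bmatrix}i+j-1\\ j-1\end{bmatrix}_q}\right)^{\binom{n-i-j}{n-k-i}},$$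 and for $0<k<n$, $$T(n,k)\;\ge\;T(n-1,k-1)\,T(n-1,k)\,(q-1)\,q^{n-k-1}\bigl((q^{n-k}-1)!\,q\bigr)^{\begin{bmatrix}n-1\\ k-1\end{bmatrix}_q}.$$ -/

import Mathlib

open Module

/-- The `q`-number `[m]_q = 1 + q + ⋯ + q ^ (m - 1)`. -/
def qNumber (q m : ℕ) : ℕ := ∑ i ∈ Finset.range m, q ^ i

/-- The `q`-factorial `[m]_q! = [m]_q [m - 1]_q ⋯ [1]_q`. -/
def qFactorial (q m : ℕ) : ℕ := ∏ i ∈ Finset.range m, qNumber q (i + 1)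

/-- The Gaussian coefficient `[n]_q! / ([k]_q! [n - k]_q!)`, used for `k ≤ n` only
(the division in `ℕ` is then exact). -/
def gaussianCoeff (q n k : ℕ) : ℕ :=
  qFactorial q n / (qFactorial q k * qFactorial q (n - k))

namespace GrassmannGray

variable {K V : Type*} [Field K] [AddCommGroup V] [Module K V]

/-- Adjacency of two `k`-dimensional subspaces in the Grassmann graph:
`dim (A ∩ B) = k - 1`, written without subtraction. -/
def Adj (k : ℕ) (A B : Submodule K V) : Prop :=
  finrank K (A ⊓ B : Submodule K V) + 1 = k

/-- `C` is a Grassmannian Gray code of `k`-dimensional subspaces of `W`: a sequence of distinct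
`k`-dimensional subspaces of `W`, any two consecutive ones being adjacent in the
Grassmann graph. -/
structure IsGrayCode (W : Submodule K V) (k : ℕ) (C : List (Submodule K V)) : Prop where
  le : ∀ A ∈ C, A ≤ W
  finrank_eq : ∀ A ∈ C, finrank K A = k
  nodup : C.Nodup
  adj : C.IsChain (Adj k)

/-- The class `[v]_U` of all vectors `α v + w` with `α ≠ 0` a scalar and `w ∈ U`. -/
def vecClass (U : Submodule K V) (v : V) : Set V :=
  {x | ∃ α : K, α ≠ 0 ∧ ∃ w ∈ U, x = α • v + w}

/-- `v 0, …, v (Q - 1)` are vectors of `W \ H` such that the subspaces `U ⊕ ⟨v a⟩` are distinct.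
If `H` is a hyperplane of `W`, `U ≤ H`, and `Q` is the number of classes `[v]_U` that
partition `W \ H`, this says that `v` lists one representative of each class. -/
def IsRepresentatives (W H U : Submodule K V) (Q : ℕ) (v : ℕ → V) : Prop :=
  (∀ a < Q, v a ∈ W ∧ v a ∉ H) ∧
    ∀ a < Q, ∀ b < Q, U ⊔ Submodule.span K {v a} = U ⊔ Submodule.span K {v b} → a = b

/-- The auxiliary sequence `C*`: for `i = 0, …, P - 1` in turn, the `Q` subspaces
`c i ⊕ ⟨v i 0⟩, …, c i ⊕ ⟨v i (Q - 1)⟩`. -/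
def auxSeq (P Q : ℕ) (c : ℕ → Submodule K V) (v : ℕ → ℕ → V) : List (Submodule K V) :=
  (List.range P).flatMap fun i =>
    (List.range Q).map fun a => c i ⊔ Submodule.span K {v i a}

/-- One step of the construction: `C` arises from the code `C' = C'_0, …, C'_{P' - 1}` and the
code `C'' = C''_0, …, C''_{P'' - 1}`, both in the hyperplane `H` of `W`, where `Q` is the number
of classes of vectors of `W \ H` induced by an entry of `C''`.

* For each entry of `C''` one lists representatives `v i 0, …, v i (Q - 1)` of all classes, so that
  the last class of each entry meets the first class of the (cyclically) next entry. If `C''` has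
  only one entry there is no next entry, and no such condition.
* One chooses `j < P'`, and `i` with `C''_i = C'_j ∩ C'_{j+1}` (indices of `C'` modulo `P'`).
  If `C'` has only one entry (then it is `H` itself), `i` is arbitrary.
* One chooses `0 ≤ ℓ ≤ Q - 2` and inserts `C'_{j+1}, …, C'_{P'-1}, C'_0, …, C'_j` directly after
  the entry of `C*` with index `i Q + ℓ`. -/
def Step (W H : Submodule K V) (Q : ℕ) (C' C'' C : List (Submodule K V)) : Prop :=
  ∃ (P' P'' : ℕ) (c' c'' : ℕ → Submodule K V) (v : ℕ → ℕ → V) (i j l : ℕ),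
    C' = (List.range P').map c' ∧
    C'' = (List.range P'').map c'' ∧
    (∀ s < P'', IsRepresentatives W H (c'' s) Q (v s)) ∧
    (∀ s, s + 1 < P'' →
      (vecClass (c'' s) (v s (Q - 1)) ∩ vecClass (c'' (s + 1)) (v (s + 1) 0)).Nonempty) ∧
    (2 ≤ P'' →
      (vecClass (c'' (P'' - 1)) (v (P'' - 1) (Q - 1)) ∩ vecClass (c'' 0) (v 0 0)).Nonempty) ∧
    j < P' ∧ i < P'' ∧ l + 1 < Q ∧
    (2 ≤ P' → c'' i = c' j ⊓ c' ((j + 1) % P')) ∧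
    C = (auxSeq P'' Q c'' v).take (i * Q + l + 1) ++ C'.rotate (j + 1) ++
        (auxSeq P'' Q c'' v).drop (i * Q + l + 1)

/-- The sequences of `k`-dimensional subspaces of `W n` produced by the recursive construction
along the chain `W 0 ≤ W 1 ≤ W 2 ≤ ⋯` (where `W n` has dimension `n`), starting from the
one-entry sequences for `k = 0` and `k = n`. An entry of the `k`-dimensional code in `W n` induces
`q ^ (n - k)` classes of vectors of `W (n + 1) \ W n`, where `q` is the order of the field. -/
inductive Produced (W : ℕ → Submodule K V) : ℕ → ℕ → List (Submodule K V) → Prop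
  | zero (n : ℕ) : Produced W n 0 [⊥]
  | full (n : ℕ) : Produced W n n [W n]
  | step (n k : ℕ) (hk : k < n) (C' C'' C : List (Submodule K V)) :
      Produced W n (k + 1) C' → Produced W n k C'' →
      Step (W (n + 1)) (W n) (Nat.card K ^ (n - k)) C' C'' C →
      Produced W (n + 1) (k + 1) C

/-- The number of distinct Grassmannian Gray codes of `k`-dimensional subspaces of `W n` that the
recursive construction along the chain `W` produces. Codes are counted as sequences,
so cyclic shifts of a code count as distinct. -/
noncomputable def numCodes (W : ℕ → Submodule K V) (n k : ℕ) : ℕ :=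
  {C : List (Submodule K V) | IsGrayCode (W n) k C ∧ Produced W n k C}.ncard

end GrassmannGray

/-! Let `H` be the hyperplane of `W`, `U ≤ H`, and `v ∈ W` outside `H`. The class `[v]_U` is exactly
the part of `U ⊕ ⟨v⟩` outside `H`. Listing representatives thus means listing the `Q = q ^ e`
extensions of `U`, the subspaces of `W` outside `H` that meet `H` in `U`; two classes meet iff the
intersection of their extensions is not contained in `H`.

Counting one step. If `A` extends `U`, and `U' ≠ U` has the same dimension, then at least `q`
extensions of `U'` meet `A` outside `H` (`card_le_ncard_meeting_extensions`). With at least two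
blocks, the first can be ordered in `Q!` ways, each middle one, constrained at its head, in at least
`q (Q - 1)!`, and the last one, constrained at both ends, in at least `q (q - 1) (Q - 2)!`.
Multiplied by the `Q - 1` values of `ℓ`, this is `(q - 1) q ^ (e - 1) ((Q - 1)! q) ^ P''`.

Invariant. By induction every produced code is cyclic and visits all subspaces of its dimension
(`IsCompleteCode.of_step`). Hence `P''` is a Gaussian coefficient and the index `i` exists. `Near`
asks only for a lower bound on the dimension, so that one-entry codes also close up to cycles.

Injectivity. Fix `j = P' - 1`, so that `C'` is inserted unrotated. In the output, the entries inside
`H` spell `C'`; the others are the blocks in order, and their traces on `H` give `C''` with each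
entry repeated `Q` times; the place of the insertion gives `ℓ`. This proves the recursive bound
(`numCodes_mul_le`), and Pascal's rule in the exponents turns it into the product. -/

/-! ### Gaussian coefficients and the exponents of the product -/

theorem qNumber_add (q a b : ℕ) : qNumber q (a + b) = qNumber q a + q ^ a * qNumber q b := by
  simp [qNumber, Finset.sum_range_add, Finset.mul_sum, pow_add]

theorem qNumber_succ_pos (q m : ℕ) : 0 < qNumber q (m + 1) := by
  rw [qNumber, Finset.sum_range_succ']
  simp

theorem qFactorial_succ (q m : ℕ) :
    qFactorial q (m + 1) = qFactorial q m * qNumber q (m + 1) := by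
  simp [qFactorial, Finset.prod_range_succ]

theorem qFactorial_pos (q m : ℕ) : 0 < qFactorial q m :=
  Finset.prod_pos fun _ _ => qNumber_succ_pos _ _

theorem qFactorial_mul_dvd (q a b : ℕ) :
    qFactorial q b * qFactorial q a ∣ qFactorial q (a + b) := by
  induction a generalizing b with
  | zero => simp [qFactorial]
  | succ a iha =>
    induction b with
    | zero => simp [qFactorial]
    | succ b ihb =>
      have h1 := iha (b + 1)
      -- Splitting the top factor as `[a + 1] + q ^ (a + 1) [b + 1]` leaves two summands, each
      -- divisible by one induction hypothesis.
      rw [show a + 1 + (b + 1) = (a + 1 + b) + 1 by ring, qFactorial_succ q (a + 1 + b),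
        show a + 1 + b + 1 = (a + 1) + (b + 1) by ring, qNumber_add, mul_add]
      refine dvd_add ?_ ?_
      · rw [qFactorial_succ q a, ← mul_assoc]
        refine mul_dvd_mul ?_ dvd_rfl
        rwa [show a + 1 + b = a + (b + 1) by ring]
      · rw [qFactorial_succ q b, mul_right_comm, mul_left_comm (qFactorial q (a + 1 + b)), ]
        exact Dvd.dvd.mul_left (mul_dvd_mul ihb dvd_rfl) _

theorem gaussianCoeff_mul (q a b : ℕ) :
    gaussianCoeff q (a + b) b * (qFactorial q b * qFactorial q a) = qFactorial q (a + b) := by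
  rw [gaussianCoeff, Nat.add_sub_cancel]
  exact Nat.div_mul_cancel (qFactorial_mul_dvd q a b)

theorem gaussianCoeff_zero (q n : ℕ) : gaussianCoeff q n 0 = 1 := by
  rw [gaussianCoeff, show qFactorial q 0 = 1 by simp [qFactorial], one_mul, Nat.sub_zero,
    Nat.div_self (qFactorial_pos q n)]

theorem gaussianCoeff_self (q n : ℕ) : gaussianCoeff q n n = 1 := by
  rw [gaussianCoeff, Nat.sub_self, show qFactorial q 0 = 1 by simp [qFactorial], mul_one,
    Nat.div_self (qFactorial_pos q n)]

/-- The `q`-Pascal rule, in the form that matches the length of a step's output: `C'` together with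
`q ^ (n - k)` entries for each entry of `C''`. -/
theorem gaussianCoeff_succ_succ (q n k : ℕ) (hk : k < n) :
    gaussianCoeff q (n + 1) (k + 1) =
      gaussianCoeff q n (k + 1) + gaussianCoeff q n k * q ^ (n - k) := by
  obtain ⟨a, rfl⟩ := Nat.exists_eq_add_of_lt hk
  have e : k + a + 1 - k = a + 1 := by omega
  rw [e]
  have h1 := gaussianCoeff_mul q (a + 1) (k + 1)
  have h2 := gaussianCoeff_mul q a (k + 1)
  have h3 := gaussianCoeff_mul q (a + 1) k
  rw [show a + 1 + (k + 1) = k + a + 1 + 1 by ring] at h1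
  rw [show a + (k + 1) = k + a + 1 by ring] at h2
  rw [show a + 1 + k = k + a + 1 by ring] at h3
  refine Nat.eq_of_mul_eq_mul_right
    (Nat.mul_pos (qFactorial_pos q (k + 1)) (qFactorial_pos q (a + 1))) ?_
  rw [h1, qFactorial_succ q (k + a + 1), show k + a + 1 + 1 = (a + 1) + (k + 1) by ring,
    qNumber_add, mul_add]
  nth_rw 1 [← h2]
  rw [← h3, qFactorial_succ q a, qFactorial_succ q k]
  ring

/-- Pascal's rule in the exponents away from the borders. For `i = a + 1` or `j = b + 1` the
binomial coefficients are 1, and the corner supplies the one new factor. -/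
theorem prod_pow_choose_succ_succ {M : Type*} [CommMonoid M] (f : ℕ → ℕ → M) (a b : ℕ) :
    (∏ i ∈ Finset.Icc 1 (a + 1), ∏ j ∈ Finset.Icc 1 (b + 1),
      f i j ^ (a + 1 + (b + 1) - i - j).choose (a + 1 - i)) =
    (∏ i ∈ Finset.Icc 1 (a + 1), ∏ j ∈ Finset.Icc 1 b,
      f i j ^ (a + 1 + b - i - j).choose (a + 1 - i)) *
    (∏ i ∈ Finset.Icc 1 a, ∏ j ∈ Finset.Icc 1 (b + 1),
      f i j ^ (a + (b + 1) - i - j).choose (a - i)) * f (a + 1) (b + 1) := by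
  have key : ∀ i ∈ Finset.Icc 1 a,
      (∏ j ∈ Finset.Icc 1 (b + 1), f i j ^ (a + 1 + (b + 1) - i - j).choose (a + 1 - i)) =
      (∏ j ∈ Finset.Icc 1 b, f i j ^ (a + 1 + b - i - j).choose (a + 1 - i)) *
      (∏ j ∈ Finset.Icc 1 (b + 1), f i j ^ (a + (b + 1) - i - j).choose (a - i)) := by
    intro i hi
    rw [Finset.mem_Icc] at hi
    rw [Finset.prod_Icc_succ_top (by omega), Finset.prod_Icc_succ_top (by omega), ← mul_assoc,
      ← Finset.prod_mul_distrib]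
    congr 1
    · refine Finset.prod_congr rfl fun j hj => ?_
      rw [Finset.mem_Icc] at hj
      rw [← pow_add]
      congr 1
      rw [show a + 1 + (b + 1) - i - j = (a + 1 + b - i - j) + 1 by omega,
        show a + 1 - i = (a - i) + 1 by omega, Nat.choose_succ_succ,
        show a + (b + 1) - i - j = a + 1 + b - i - j by omega, add_comm]
    · rw [show a + 1 + (b + 1) - i - (b + 1) = a + 1 - i by omega,
        show a + (b + 1) - i - (b + 1) = a - i by omega, Nat.choose_self, Nat.choose_self]
  rw [Finset.prod_Icc_succ_top (by omega), Finset.prod_Icc_succ_top (by omega : 1 ≤ a + 1),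
    Finset.prod_congr rfl key, Finset.prod_mul_distrib, Nat.sub_self]
  simp only [Nat.choose_zero_right, pow_one]
  rw [Finset.prod_Icc_succ_top (by omega), ← mul_assoc]
  congr 1
  rw [mul_right_comm]

/-! ### Counting block listings with linked ends -/

section Counting

open scoped Nat

/-- The product principle for lower bounds: at least `m` second choices after each first choice,
both recoverable from the outcome. -/
theorem exists_finset_of_fibers {ι β γ : Type*} (A : Finset ι) (p : ι → β → Prop) (m : ℕ)
    (h : ∀ i ∈ A, ∃ B : Finset β, (∀ b ∈ B, p i b) ∧ m ≤ B.card) (f : ι → β → γ)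
    (hf : ∀ i ∈ A, ∀ i' ∈ A, ∀ b b', p i b → p i' b' → f i b = f i' b' → i = i' ∧ b = b') :
    ∃ F : Finset γ, (∀ c ∈ F, ∃ i ∈ A, ∃ b, p i b ∧ f i b = c) ∧ A.card * m ≤ F.card := by
  classical
  choose! B hB hm using h
  refine ⟨(A.sigma B).image fun x => f x.1 x.2, ?_, ?_⟩
  · intro c hc
    simp only [Finset.mem_image, Finset.mem_sigma] at hc
    obtain ⟨x, ⟨h1, h2⟩, h3⟩ := hc
    exact ⟨x.1, h1, x.2, hB _ h1 _ h2, h3⟩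
  · rw [Finset.card_image_of_injOn, Finset.card_sigma]
    · exact Finset.card_nsmul_le_sum A _ m hm
    · rintro ⟨i, b⟩ hi ⟨i', b'⟩ hi' e
      simp only [Finset.coe_sigma, Set.mem_sigma_iff, Finset.mem_coe] at hi hi'
      obtain ⟨rfl, rfl⟩ := hf i hi.1 i' hi'.1 b b' (hB _ hi.1 _ hi.2) (hB _ hi'.1 _ hi'.2) e
      rfl

variable {α : Type*}

theorem perm_toList_cons [DecidableEq α] {X : Finset α} {x : α} (hx : x ∈ X) {l : List α}
    (h : l.Perm (X.erase x).toList) : (x :: l).Perm X.toList := by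
  have := Finset.toList_insert (Finset.notMem_erase x X)
  rw [Finset.insert_erase hx] at this
  exact (h.cons x).trans this.symm

theorem exists_listings (X : Finset α) :
    ∃ F : Finset (List α), (∀ l ∈ F, l.Perm X.toList) ∧ X.card ! ≤ F.card := by
  classical
  refine ⟨X.toList.permutations.toFinset, fun l hl => by simpa using hl, ?_⟩
  rw [List.toFinset_card_of_nodup (List.nodup_permutations _ X.nodup_toList),
    List.length_permutations, Finset.length_toList]

theorem exists_listings_head (X S : Finset α) (hS : S ⊆ X) :
    ∃ F : Finset (List α), (∀ l ∈ F, l.Perm X.toList ∧ ∃ x ∈ S, l.head? = some x) ∧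
      S.card * (X.card - 1)! ≤ F.card := by
  classical
  obtain ⟨F, hF, hc⟩ := exists_finset_of_fibers S
    (fun x l => x ∈ S ∧ l.Perm (X.erase x).toList) (X.card - 1)!
    (fun x hx => by
      obtain ⟨F, h1, h2⟩ := exists_listings (X.erase x)
      rw [Finset.card_erase_of_mem (hS hx)] at h2
      exact ⟨F, fun l hl => ⟨hx, h1 l hl⟩, h2⟩)
    (fun x l => x :: l) (by rintro x - x' - l l' - - h; simpa using h)
  refine ⟨F, fun l hl => ?_, hc⟩
  obtain ⟨x, hx, l', ⟨-, hl'⟩, rfl⟩ := hF l hl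
  exact ⟨perm_toList_cons (hS hx) hl', x, hx, rfl⟩

theorem exists_listings_getLast (X T : Finset α) (hT : T ⊆ X) :
    ∃ F : Finset (List α), (∀ l ∈ F, l.Perm X.toList ∧ ∃ x ∈ T, l.getLast? = some x) ∧
      T.card * (X.card - 1)! ≤ F.card := by
  classical
  obtain ⟨F, hF, hc⟩ := exists_listings_head X T hT
  refine ⟨F.image List.reverse, fun l hl => ?_, ?_⟩
  · obtain ⟨l', hl', rfl⟩ := Finset.mem_image.1 hl
    obtain ⟨h1, x, hx, h2⟩ := hF l' hl'
    exact ⟨(List.reverse_perm l').trans h1, x, hx, by simpa using h2⟩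
  · rwa [Finset.card_image_of_injective _ List.reverse_injective]

theorem exists_listings_head_getLast (X S T : Finset α) (hS : S ⊆ X) (hT : T ⊆ X) :
    ∃ F : Finset (List α), (∀ l ∈ F, l.Perm X.toList ∧ (∃ x ∈ S, l.head? = some x) ∧
      ∃ y ∈ T, l.getLast? = some y) ∧ S.card * ((T.card - 1) * (X.card - 2)!) ≤ F.card := by
  classical
  obtain ⟨F, hF, hc⟩ := exists_finset_of_fibers S
    (fun x l => l.Perm (X.erase x).toList ∧ ∃ y ∈ T, l.getLast? = some y)
    -- The chosen head may itself lie in `T`, which costs one candidate for the last entry.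
    ((T.card - 1) * (X.card - 2)!)
    (fun x hx => by
      obtain ⟨F, h1, h2⟩ := exists_listings_getLast (X.erase x) (T.erase x)
        (Finset.erase_subset_erase x hT)
      rw [Finset.card_erase_of_mem (hS hx), Nat.sub_sub] at h2
      refine ⟨F, fun l hl => ?_, le_trans (Nat.mul_le_mul_right _ ?_) h2⟩
      · obtain ⟨h3, y, hy, h4⟩ := h1 l hl
        exact ⟨h3, y, Finset.mem_of_mem_erase hy, h4⟩
      · exact Finset.pred_card_le_card_erase)
    (fun x l => x :: l) (by rintro x - x' - l l' - - h; simpa using h)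
  refine ⟨F, fun l hl => ?_, hc⟩
  obtain ⟨x, hx, l', ⟨hl', y, hy, hy'⟩, rfl⟩ := hF l hl
  exact ⟨perm_toList_cons (hS hx) hl', ⟨x, hx, rfl⟩, y, hy, by simp [List.getLast?_cons, hy']⟩

/-- The last entry of `l` is related to the first entry of `l'`. -/
def Joins (R : α → α → Prop) (l l' : List α) : Prop :=
  ∃ x, l.getLast? = some x ∧ ∃ y, l'.head? = some y ∧ R x y

/-- `L` lists, block by block, the elements of the entries of `Xs`. -/
def IsBlockListing (L : List (List α)) (Xs : List (Finset α)) : Prop :=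
  List.Forall₂ (fun l X => l.Perm X.toList) L Xs

/-- A list that is a chain for `R` when it is closed up to a cycle. -/
def IsCyclicChain {β : Type*} (R : β → β → Prop) (l : List β) : Prop :=
  l.IsChain R ∧ ∀ a ∈ l.getLast?, ∀ b ∈ l.head?, R a b

-- Induction on the blocks, ordering them from left to right between two fixed lists. Every block
-- has its head linked to the preceding list; only the final one must also link to `l₁`, which gives
-- its different factor.
open Classical in
theorem exists_blockListings_between (R : α → α → Prop) (Q q : ℕ)
    (l₁ : List α) (b : α) (hb : l₁.head? = some b) (X : Finset α) (Xs : List (Finset α)) :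
    ∀ (l₀ : List α) (a : α), l₀.getLast? = some a →
    (∀ Y ∈ X :: Xs, Y.card = Q) → q ≤ {y ∈ X | R a y}.card →
    (X :: Xs).IsChain (fun Y Z : Finset α => ∀ x ∈ Y, q ≤ {y ∈ Z | R x y}.card) →
    (∀ Y ∈ (X :: Xs).getLast?, q ≤ {x ∈ Y | R x b}.card) →
    ∃ F : Finset (List (List α)),
      (∀ L ∈ F, IsBlockListing L (X :: Xs) ∧ (l₀ :: (L ++ [l₁])).IsChain (Joins R)) ∧
      (q * (Q - 1)!) ^ Xs.length * (q * ((q - 1) * (Q - 2)!)) ≤ F.card := by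
  induction Xs generalizing X with
  | nil =>
    intro l₀ a ha hcard h1 _ h2
    have hXQ : X.card = Q := hcard X (by simp)
    replace h2 := h2 X (by simp)
    obtain ⟨F, hF, hc⟩ := exists_listings_head_getLast X {y ∈ X | R a y} {x ∈ X | R x b}
      (Finset.filter_subset _ _) (Finset.filter_subset _ _)
    refine ⟨F.image fun l => [l], fun L hL => ?_, ?_⟩
    · obtain ⟨l, hl, rfl⟩ := Finset.mem_image.1 hL
      obtain ⟨h3, ⟨x, hx, hx'⟩, y, hy, hy'⟩ := hF l hl
      refine ⟨by simpa [IsBlockListing] using h3, ?_⟩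
      simp only [List.cons_append, List.nil_append, List.isChain_cons_cons, List.IsChain.singleton,
        and_true]
      exact ⟨⟨a, ha, x, hx', (Finset.mem_filter.1 hx).2⟩, y, hy', b, hb, (Finset.mem_filter.1 hy).2⟩
    · rw [Finset.card_image_of_injective _ fun l l' h => by simpa using h]
      rw [hXQ] at hc
      refine le_trans ?_ hc
      simp only [List.length_nil, pow_zero, one_mul]
      gcongr
  | cons Y Xs ih =>
    intro l₀ a ha hcard h1 hch h2
    have hXQ : X.card = Q := hcard X (by simp)
    obtain ⟨F, hF, hc⟩ := exists_listings_head X {y ∈ X | R a y} (Finset.filter_subset _ _)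
    rw [List.isChain_cons_cons] at hch
    obtain ⟨G, hG, hGc⟩ := exists_finset_of_fibers F
      (fun l L => IsBlockListing L (Y :: Xs) ∧ (l :: (L ++ [l₁])).IsChain (Joins R))
      ((q * (Q - 1)!) ^ Xs.length * (q * ((q - 1) * (Q - 2)!)))
      (fun l hl => by
        have hne : l ≠ [] := by
          rintro rfl
          obtain ⟨-, x, -, h⟩ := hF _ hl
          simp at h
        refine ih Y l (l.getLast hne) (List.getLast?_eq_some_getLast hne)
          (fun Z hZ => hcard Z (List.mem_cons_of_mem _ hZ)) (hch.1 _ ?_) hch.2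
          (fun Z hZ => h2 Z (by simpa [List.getLast?_cons] using hZ))
        rw [← Finset.mem_toList, ← (hF l hl).1.mem_iff]
        exact List.getLast_mem hne)
      (fun l L => l :: L) (by rintro x - x' - l l' - - h; simpa using h)
    refine ⟨G, fun L hL => ?_, ?_⟩
    · obtain ⟨l, hl, L, ⟨h3, h4⟩, rfl⟩ := hG L hL
      obtain ⟨h5, x, hx, hx'⟩ := hF l hl
      refine ⟨List.Forall₂.cons h5 h3, ?_⟩
      rw [List.cons_append, List.isChain_cons_cons]
      exact ⟨⟨a, ha, x, hx', (Finset.mem_filter.1 hx).2⟩, h4⟩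
    · refine le_trans ?_ hGc
      rw [List.length_cons, pow_succ', mul_assoc]
      refine Nat.mul_le_mul_right _ (le_trans ?_ hc)
      rw [hXQ]
      gcongr

-- The factor `q ^ e - 1` on the right stands for the choice of `ℓ`; it completes `(q ^ e - 2)!` to
-- `(q ^ e - 1)!`. The cyclic condition is obtained by using the first block as both ends of the
-- listing of the others.
open Classical in
theorem exists_cyclic_blockListings (R : α → α → Prop) (q e : ℕ) (hq : 2 ≤ q) (he : 1 ≤ e)
    (Xs : List (Finset α)) (hne : Xs ≠ []) (hnd : Xs.Nodup) (hcard : ∀ X ∈ Xs, X.card = q ^ e)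
    (hR : ∀ X ∈ Xs, ∀ Y ∈ Xs, X ≠ Y → ∀ x ∈ X, q ≤ {y ∈ Y | R x y}.card)
    (hR' : ∀ X ∈ Xs, ∀ Y ∈ Xs, X ≠ Y → ∀ x ∈ X, q ≤ {y ∈ Y | R y x}.card) :
    ∃ F : Finset (List (List α)),
      (∀ L ∈ F, IsBlockListing L Xs ∧ (2 ≤ Xs.length → IsCyclicChain (Joins R) L)) ∧
      (q - 1) * q ^ (e - 1) * ((q ^ e - 1)! * q) ^ Xs.length ≤ F.card * (q ^ e - 1) := by
  have hqQ : q ≤ q ^ e := Nat.le_self_pow (by omega) q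
  have hQe : q ^ e = q ^ (e - 1) * q := by rw [← pow_succ]; congr; omega
  have hfac : (q ^ e)! = q ^ e * (q ^ e - 1)! := (Nat.mul_factorial_pred (by omega)).symm
  obtain ⟨X, Xs, rfl⟩ := List.exists_cons_of_ne_nil hne
  obtain ⟨F, hF, hc⟩ := exists_listings X
  rw [hcard X (by simp)] at hc
  cases Xs with
  | nil =>
    refine ⟨F.image fun l => [l], fun L hL => ?_, ?_⟩
    · obtain ⟨l, hl, rfl⟩ := Finset.mem_image.1 hL
      exact ⟨by simpa [IsBlockListing] using hF l hl, by simp⟩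
    · rw [Finset.card_image_of_injective _ fun l l' h => by simpa using h]
      -- A single block has no linking condition: its `(q ^ e)!` orders suffice because `q - 1 ≤ q ^
      -- e - 1`.
      calc _ = (q ^ (e - 1) * q * (q ^ e - 1)!) * (q - 1) := by simp; ring
        _ ≤ _ := by
          rw [← hQe, ← hfac]
          gcongr
  | cons Y Xs =>
    obtain ⟨G, hG, hGc⟩ := exists_finset_of_fibers F
      (fun l L => IsBlockListing L (Y :: Xs) ∧ (l :: (L ++ [l])).IsChain (Joins R))
      ((q * (q ^ e - 1)!) ^ Xs.length * (q * ((q - 1) * (q ^ e - 2)!)))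
      (fun l hl => by
        have hl' := hF l hl
        have hne : l ≠ [] := by
          rintro rfl
          have := hcard X (by simp)
          have h0 := hl'.length_eq
          simp only [List.length_nil, Finset.length_toList] at h0
          omega
        have hmem : ∀ x ∈ l, x ∈ X := fun x hx => by
          rwa [← Finset.mem_toList, ← hl'.mem_iff]
        rw [List.nodup_cons] at hnd
        refine exists_blockListings_between R (q ^ e) q l (l.head hne)
          (List.head?_eq_some_head hne) Y Xs l (l.getLast hne) (List.getLast?_eq_some_getLast hne)
          (fun Z hZ => hcard Z (List.mem_cons_of_mem _ hZ)) ?_ ?_ ?_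
        · exact hR X (by simp) Y (by simp) (fun h => hnd.1 (by simp [h])) _
            (hmem _ (List.getLast_mem hne))
        · refine List.Pairwise.isChain (List.Pairwise.imp_of_mem ?_ hnd.2)
          intro A B hA hB hAB
          exact hR A (List.mem_cons_of_mem _ hA) B (List.mem_cons_of_mem _ hB) hAB
        · intro Z hZ
          have hZ' := List.mem_of_getLast? hZ
          exact hR' X (by simp) Z (List.mem_cons_of_mem _ hZ') (fun h => hnd.1 (h ▸ hZ')) _
            (hmem _ (List.head_mem hne)))
      (fun l L => l :: L) (by rintro x - x' - l l' - - h; simpa using h)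
    refine ⟨G, fun L hL => ?_, ?_⟩
    · obtain ⟨l, hl, L, ⟨h3, h4⟩, rfl⟩ := hG L hL
      refine ⟨List.Forall₂.cons (hF l hl) h3, fun _ => ?_⟩
      rw [← List.cons_append, List.isChain_append] at h4
      exact ⟨h4.1, fun a ha b hb => h4.2.2 a ha b (by simpa using hb)⟩
    · refine le_trans ?_ (Nat.mul_le_mul_right _ hGc)
      have hfac' : (q ^ e - 1)! = (q ^ e - 1) * (q ^ e - 2)! := by
        rw [← Nat.mul_factorial_pred (by omega : q ^ e - 1 ≠ 0), Nat.sub_sub]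
      calc _ = (q ^ (e - 1) * q * (q ^ e - 1)!) * ((q * (q ^ e - 1)!) ^ Xs.length *
            (q * ((q - 1) * (q ^ e - 1)!))) := by
              simp only [List.length_cons, pow_succ, mul_pow]; ring
        _ = (q ^ e)! * ((q * (q ^ e - 1)!) ^ Xs.length * (q * ((q - 1) * (q ^ e - 2)!))) *
            (q ^ e - 1) := by
              rw [← hQe, ← hfac, show q * ((q - 1) * (q ^ e - 1)!) =
                q * ((q - 1) * (q ^ e - 2)!) * (q ^ e - 1) by rw [hfac']; ring]
              ring
        _ ≤ _ := by gcongr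

end Counting

/-! ### Vector classes as extensions of a subspace of a hyperplane -/

namespace GrassmannGray

variable {K V : Type*} [Field K] [AddCommGroup V] [Module K V]

/-- The subspaces of `W`, not contained in `H`, that meet `H` in `U`. -/
def extensions (W H U : Submodule K V) : Set (Submodule K V) :=
  {A | A ≤ W ∧ ¬ A ≤ H ∧ A ⊓ H = U}

theorem sup_span_mem_extensions {W H U : Submodule K V} (hHW : H ≤ W) (hU : U ≤ H) {v : V}
    (hv : v ∈ W) (hv' : v ∉ H) : U ⊔ Submodule.span K {v} ∈ extensions W H U := by
  have hvs : v ∈ U ⊔ Submodule.span K {v} :=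
    (le_sup_right : _ ≤ U ⊔ _) (Submodule.mem_span_singleton_self v)
  refine ⟨sup_le (hU.trans hHW) (by simpa using hv), fun h => hv' (h hvs), ?_⟩
  rw [sup_inf_assoc_of_le _ hU, sup_eq_left]
  rintro x ⟨hx, hxH⟩
  obtain ⟨c, rfl⟩ := Submodule.mem_span_singleton.1 hx
  by_cases hc : c = 0
  · simp [hc]
  · exact absurd ((H.smul_mem_iff hc).1 hxH) hv'

theorem exists_mem_notMem_of_mem_extensions {W H U A : Submodule K V}
    (hA : A ∈ extensions W H U) : ∃ v ∈ A, v ∉ H := SetLike.not_le_iff_exists.1 hA.2.1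

theorem vecClass_subset {U : Submodule K V} {v x : V} (hx : x ∈ vecClass U v) :
    x ∈ U ⊔ Submodule.span K {v} := by
  obtain ⟨α, -, w, hw, rfl⟩ := hx
  exact Submodule.add_mem _
    ((le_sup_right : _ ≤ U ⊔ _) (Submodule.smul_mem _ _ (Submodule.mem_span_singleton_self v)))
    ((le_sup_left : U ≤ _) hw)

theorem notMem_of_mem_vecClass {H U : Submodule K V} (hU : U ≤ H) {v x : V} (hv : v ∉ H)
    (hx : x ∈ vecClass U v) : x ∉ H := by
  obtain ⟨α, hα, w, hw, rfl⟩ := hx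
  intro h
  have := H.sub_mem h (hU hw)
  rw [add_sub_cancel_right, H.smul_mem_iff hα] at this
  exact hv this

theorem mem_vecClass {H U : Submodule K V} (hU : U ≤ H) {v x : V}
    (hx : x ∈ U ⊔ Submodule.span K {v}) (hx' : x ∉ H) : x ∈ vecClass U v := by
  obtain ⟨w, hw, y, hy, rfl⟩ := Submodule.mem_sup.1 hx
  obtain ⟨α, rfl⟩ := Submodule.mem_span_singleton.1 hy
  refine ⟨α, ?_, w, hw, add_comm _ _⟩
  rintro rfl
  exact hx' (by simpa using hU hw)

/-- Each class is the part of the corresponding extension outside `H`, so a common vector is a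
vector of the intersection outside `H`. -/
theorem vecClass_inter_nonempty_iff {H U U' : Submodule K V} (hU : U ≤ H) (hU' : U' ≤ H)
    {v v' : V} (hv : v ∉ H) : (vecClass U v ∩ vecClass U' v').Nonempty ↔
      ¬ (U ⊔ Submodule.span K {v}) ⊓ (U' ⊔ Submodule.span K {v'}) ≤ H := by
  rw [SetLike.not_le_iff_exists]
  constructor
  · rintro ⟨x, hx, hx'⟩
    exact ⟨x, ⟨vecClass_subset hx, vecClass_subset hx'⟩, notMem_of_mem_vecClass hU hv hx⟩
  · rintro ⟨x, ⟨hx, hx'⟩, hxH⟩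
    exact ⟨x, mem_vecClass hU hx hxH, mem_vecClass hU' hx' hxH⟩

variable [FiniteDimensional K V]

section Hyperplane

variable {W H U : Submodule K V} (hHW : H ≤ W) (hdim : finrank K W = finrank K H + 1)
include hHW hdim

theorem sup_eq_of_not_le {A : Submodule K V} (hA : A ≤ W) (hAH : ¬ A ≤ H) : A ⊔ H = W := by
  refine Submodule.eq_of_le_of_finrank_le (sup_le hA hHW) ?_
  have : H < A ⊔ H := right_lt_sup.2 hAH
  have := Submodule.finrank_lt_finrank_of_lt this
  omega

theorem finrank_inf_add_one {A : Submodule K V} (hA : A ≤ W) (hAH : ¬ A ≤ H) :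
    finrank K (A ⊓ H : Submodule K V) + 1 = finrank K A := by
  have := Submodule.finrank_sup_add_finrank_inf_eq A H
  rw [sup_eq_of_not_le hHW hdim hA hAH] at this
  omega

theorem finrank_of_mem_extensions {A : Submodule K V} (hA : A ∈ extensions W H U) :
    finrank K A = finrank K U + 1 := by
  rw [← finrank_inf_add_one hHW hdim hA.1 hA.2.1, hA.2.2]

theorem eq_sup_span_of_mem_extensions {A : Submodule K V} (hA : A ∈ extensions W H U) {v : V}
    (hv : v ∈ A) (hv' : v ∉ H) : A = U ⊔ Submodule.span K {v} := by
  have hUA : U ≤ A := hA.2.2 ▸ inf_le_left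
  have hUH : U ≤ H := hA.2.2 ▸ inf_le_right
  refine (Submodule.eq_of_le_of_finrank_eq (sup_le hUA (by simpa using hv)) ?_).symm
  rw [finrank_of_mem_extensions hHW hdim hA,
    finrank_of_mem_extensions hHW hdim (sup_span_mem_extensions hHW hUH (hA.1 hv) hv')]

theorem exists_add_mem_of_mem_extensions {A : Submodule K V} (hA : A ∈ extensions W H U) {w : V}
    (hw : w ∈ W) : ∃ h ∈ H, w + h ∈ A := by
  rw [← sup_eq_of_not_le hHW hdim hA.1 hA.2.1] at hw
  obtain ⟨a, ha, h, hh, rfl⟩ := Submodule.mem_sup.1 hw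
  exact ⟨-h, H.neg_mem hh, by simpa using ha⟩

omit hHW in
theorem exists_mem_notMem_hyperplane : ∃ w ∈ W, w ∉ H := by
  refine SetLike.not_le_iff_exists.1 fun h => ?_
  have := Submodule.finrank_mono h
  omega

theorem ncard_extensions [Finite K] (hU : U ≤ H) :
    (extensions W H U).ncard = Nat.card K ^ (finrank K H - finrank K U) := by
  -- For a fixed `w` in `W` outside `H`, the vectors `w + h`, with `h` in a complement `U'` of `U`
  -- in `H`, span each extension over `U` exactly once.
  obtain ⟨U', hdis, hsup⟩ := IsModularLattice.exists_disjoint_and_sup_eq hU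
  obtain ⟨w, hw, hwH⟩ := exists_mem_notMem_hyperplane hdim
  have hU' : U' ≤ H := hsup ▸ le_sup_right
  have hrank : finrank K U' = finrank K H - finrank K U := by
    have := Submodule.finrank_sup_add_finrank_inf_eq U U'
    rw [hsup, hdis.eq_bot, finrank_bot] at this
    omega
  have hmem : ∀ h ∈ U', w + h ∈ W ∧ w + h ∉ H := fun h hh =>
    ⟨W.add_mem hw (hHW (hU' hh)), fun h' => hwH (by simpa using H.sub_mem h' (hU' hh))⟩
  have hinj : Function.Injective fun h : U' => U ⊔ Submodule.span K {w + (h : V)} := by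
    intro x y hxy
    have hx := sup_span_mem_extensions hHW hU (hmem x x.2).1 (hmem x x.2).2
    have h1 : w + (x : V) ∈ U ⊔ Submodule.span K {w + (x : V)} :=
      (le_sup_right : _ ≤ U ⊔ _) (Submodule.mem_span_singleton_self _)
    have h2 : w + (y : V) ∈ U ⊔ Submodule.span K {w + (x : V)} := by
      simp only at hxy
      rw [hxy]
      exact (le_sup_right : _ ≤ U ⊔ _) (Submodule.mem_span_singleton_self _)
    have h3 : (x : V) - y ∈ U := by
      rw [← hx.2.2]
      refine ⟨?_, H.sub_mem (hU' x.2) (hU' y.2)⟩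
      simpa using Submodule.sub_mem _ h1 h2
    have h4 : (x : V) - y ∈ U ⊓ U' := ⟨h3, U'.sub_mem x.2 y.2⟩
    rw [hdis.eq_bot, Submodule.mem_bot, sub_eq_zero] at h4
    exact Subtype.ext h4
  have hrange : Set.range (fun h : U' => U ⊔ Submodule.span K {w + (h : V)}) =
      extensions W H U := by
    ext A
    constructor
    · rintro ⟨h, rfl⟩
      exact sup_span_mem_extensions hHW hU (hmem h h.2).1 (hmem h h.2).2
    · intro hA
      obtain ⟨h, hh, hwA⟩ := exists_add_mem_of_mem_extensions hHW hdim hA hw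
      rw [← hsup] at hh
      obtain ⟨u, hu, u', hu', rfl⟩ := Submodule.mem_sup.1 hh
      have hUA : U ≤ A := hA.2.2 ▸ inf_le_left
      refine ⟨⟨u', hu'⟩, (eq_sup_span_of_mem_extensions hHW hdim hA ?_ (hmem u' hu').2).symm⟩
      have := A.sub_mem hwA (hUA hu)
      rwa [show w + (u + u') - u = w + u' by abel] at this
  have : Finite V := Module.finite_of_finite K
  rw [← hrange, Set.ncard_range_of_injective hinj, Module.natCard_eq_pow_finrank (K := K), hrank]

-- Take `u ∈ U` not in `U'` and `x ∈ A` outside `H`. The `q` vectors `x + c u` all lie in `A`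
-- outside `H`, and they span different extensions over `U'`, since a coincidence would put a
-- nonzero multiple of `u` into `U'`.
omit hdim in
theorem card_le_ncard_meeting_extensions [Finite K] {U' A : Submodule K V} (hU' : U' ≤ H)
    (hUU' : ¬ U ≤ U') (hA : A ∈ extensions W H U) :
    Nat.card K ≤ {B ∈ extensions W H U' | ¬ A ⊓ B ≤ H}.ncard := by
  obtain ⟨u, hu, hu'⟩ := SetLike.not_le_iff_exists.1 hUU'
  obtain ⟨x, hx, hxH⟩ := exists_mem_notMem_of_mem_extensions hA
  have hUA : U ≤ A := hA.2.2 ▸ inf_le_left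
  have huH : u ∈ H := (hA.2.2 ▸ inf_le_right : U ≤ H) hu
  have hmemA : ∀ c : K, x + c • u ∈ A := fun c => A.add_mem hx (A.smul_mem c (hUA hu))
  have hnH : ∀ c : K, x + c • u ∉ H := fun c h =>
    hxH (by simpa using H.sub_mem h (H.smul_mem c huH))
  have hmem : ∀ c : K, x + c • u ∈ U' ⊔ Submodule.span K {x + c • u} := fun c =>
    (le_sup_right : _ ≤ U' ⊔ _) (Submodule.mem_span_singleton_self _)
  have hext : ∀ c : K, U' ⊔ Submodule.span K {x + c • u} ∈ extensions W H U' := fun c =>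
    sup_span_mem_extensions hHW hU' (hA.1 (hmemA c)) (hnH c)
  have hinj : Function.Injective fun c : K => U' ⊔ Submodule.span K {x + c • u} := by
    intro c d hcd
    by_contra hne
    simp only at hcd
    have h1 := hmem d
    rw [← hcd] at h1
    have h2 := Submodule.sub_mem _ (hmem c) h1
    have h3 : (c - d) • u ∈ U' := by
      rw [← (hext c).2.2]
      refine ⟨?_, H.smul_mem _ huH⟩
      rw [sub_smul]
      simpa using h2
    exact hu' ((U'.smul_mem_iff (sub_ne_zero.2 hne)).1 h3)
  have : Finite V := Module.finite_of_finite K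
  rw [← Set.ncard_range_of_injective hinj]
  refine Set.ncard_le_ncard ?_ (Set.toFinite _)
  rintro _ ⟨c, rfl⟩
  exact ⟨hext c, fun h => hnH c (h ⟨hmemA c, hmem c⟩)⟩

end Hyperplane

end GrassmannGray

/-! ### Rotating cyclic chains and inserting into them -/

theorem IsCyclicChain.append_comm {β : Type*} {R : β → β → Prop} {l l' : List β}
    (h : IsCyclicChain R (l ++ l')) : IsCyclicChain R (l' ++ l) := by
  by_cases hl : l = []
  · simpa [hl] using h
  by_cases hl' : l' = []
  · simpa [hl'] using h
  obtain ⟨h1, h2⟩ := h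
  rw [List.isChain_append] at h1
  rw [List.getLast?_append_of_ne_nil _ hl', List.head?_append_of_ne_nil _ hl] at h2
  refine ⟨List.isChain_append.2 ⟨h1.2.1, h1.1, h2⟩, ?_⟩
  rw [List.getLast?_append_of_ne_nil _ hl, List.head?_append_of_ne_nil _ hl']
  exact h1.2.2

theorem IsCyclicChain.rotate {β : Type*} {R : β → β → Prop} {l : List β}
    (h : IsCyclicChain R l) {n : ℕ} (hn : n ≤ l.length) : IsCyclicChain R (l.rotate n) := by
  rw [List.rotate_eq_drop_append_take hn]
  apply IsCyclicChain.append_comm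
  rwa [List.take_append_drop]

theorem IsCyclicChain.insert {β : Type*} {R : β → β → Prop} {l l' m : List β}
    (h : IsCyclicChain R (l ++ l')) (hm : m.IsChain R) (hl : l ≠ []) (hl' : l' ≠ []) (hm0 : m ≠ [])
    (h1 : ∀ a ∈ l.getLast?, ∀ b ∈ m.head?, R a b) (h2 : ∀ a ∈ m.getLast?, ∀ b ∈ l'.head?, R a b) :
    IsCyclicChain R (l ++ m ++ l') := by
  obtain ⟨h3, h4⟩ := h
  rw [List.isChain_append] at h3
  rw [List.getLast?_append_of_ne_nil _ hl', List.head?_append_of_ne_nil _ hl] at h4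
  refine ⟨List.isChain_append.2 ⟨List.isChain_append.2 ⟨h3.1, hm, h1⟩, h3.2.1, ?_⟩, ?_⟩
  · rwa [List.getLast?_append_of_ne_nil _ hm0]
  · rwa [List.getLast?_append_of_ne_nil _ hl', List.append_assoc, List.head?_append_of_ne_nil _ hl]

/-! ### Every produced code is cyclic and complete -/

namespace GrassmannGray

variable {K V : Type*} [Field K] [AddCommGroup V] [Module K V]

/-- The subspaces `A` and `B` meet in dimension at least `k - 1`. -/
def Near (k : ℕ) (A B : Submodule K V) : Prop :=
  k ≤ finrank K (A ⊓ B : Submodule K V) + 1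

/-- `C` is a cyclic Gray code that visits every `k`-dimensional subspace of `W`. -/
structure IsCompleteCode (W : Submodule K V) (k : ℕ) (C : List (Submodule K V)) : Prop where
  nodup : C.Nodup
  mem_iff : ∀ A, A ∈ C ↔ A ≤ W ∧ finrank K A = k
  cyclic : IsCyclicChain (Near k) C

theorem auxSeq_eq_map (P Q : ℕ) (hQ : 0 < Q) (c : ℕ → Submodule K V) (v : ℕ → ℕ → V) :
    auxSeq P Q c v = (List.range (P * Q)).map fun t =>
      c (t / Q) ⊔ Submodule.span K {v (t / Q) (t % Q)} := by
  induction P with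
  | zero => simp [auxSeq]
  | succ P ih =>
    rw [auxSeq, List.range_succ, List.flatMap_append, ← auxSeq, ih, Nat.succ_mul, List.range_add,
      List.map_append]
    congr 1
    rw [List.flatMap_singleton, List.map_map]
    refine List.map_congr_left fun a ha => ?_
    have ha := List.mem_range.1 ha
    have h1 : (P * Q + a) / Q = P := by
      rw [mul_comm, Nat.mul_add_div hQ, Nat.div_eq_of_lt ha, add_zero]
    have h2 : (P * Q + a) % Q = a := by
      rw [mul_comm, Nat.mul_add_mod, Nat.mod_eq_of_lt ha]
    simp [h1, h2]

theorem isCyclicChain_map_range {β : Type*} {R : β → β → Prop} (N : ℕ) (g : ℕ → β)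
    (h : ∀ t, t + 1 < N → R (g t) (g (t + 1))) (h' : 0 < N → R (g (N - 1)) (g 0)) :
    IsCyclicChain R ((List.range N).map g) := by
  refine ⟨?_, ?_⟩
  · rw [List.isChain_iff_getElem]
    intro i hi
    simpa using h i (by simpa using hi)
  · rcases N with _ | N
    · simp
    · rw [List.getLast?_map, List.head?_map, List.getLast?_range, List.head?_range]
      simpa using h' (by omega)

variable [FiniteDimensional K V]

theorem near_of_le {k : ℕ} {U A B : Submodule K V} (hU : finrank K U = k) (hA : U ≤ A)
    (hB : U ≤ B) : Near (k + 1) A B := by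
  have := Submodule.finrank_mono (le_inf hA hB)
  unfold Near
  omega

/-- Since `A ⊓ B` leaves the hyperplane, its dimension is one more than that of its trace `U ⊓ U'`.
-/
theorem near_of_meets {k : ℕ} {W H U U' A B : Submodule K V} (hHW : H ≤ W)
    (hdim : finrank K W = finrank K H + 1) (hUU' : Near k U U') (hA : A ∈ extensions W H U)
    (hB : B ∈ extensions W H U') (hAB : ¬ A ⊓ B ≤ H) : Near (k + 1) A B := by
  have h := finrank_inf_add_one hHW hdim (inf_le_left.trans hA.1) hAB
  rw [inf_inf_distrib_right, hA.2.2, hB.2.2] at h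
  unfold Near at *
  omega

theorem adj_of_near {k : ℕ} {A B : Submodule K V} (hA : finrank K A = k) (hB : finrank K B = k)
    (hAB : A ≠ B) (h : Near k A B) : Adj k A B := by
  have h1 : A ⊓ B < A := by
    refine lt_of_le_of_ne inf_le_left fun h => hAB ?_
    exact Submodule.eq_of_le_of_finrank_eq (inf_eq_left.1 h) (hA.trans hB.symm)
  have := Submodule.finrank_lt_finrank_of_lt h1
  unfold Near at h
  unfold Adj
  omega

theorem IsCompleteCode.isGrayCode {W : Submodule K V} {k : ℕ} {C : List (Submodule K V)}
    (h : IsCompleteCode W k C) : IsGrayCode W k C where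
  le A hA := ((h.mem_iff A).1 hA).1
  finrank_eq A hA := ((h.mem_iff A).1 hA).2
  nodup := h.nodup
  adj := by
    have := h.cyclic.1
    rw [List.isChain_iff_getElem] at this ⊢
    intro i hi
    refine adj_of_near ((h.mem_iff _).1 (List.getElem_mem _)).2
      ((h.mem_iff _).1 (List.getElem_mem _)).2 (fun e => ?_) (this i hi)
    have := (h.nodup.getElem_inj_iff).1 e
    omega

theorem exists_finrank_succ_between {U H : Submodule K V} (hU : U ≤ H)
    (hlt : finrank K U < finrank K H) :
    ∃ B, U ≤ B ∧ B ≤ H ∧ finrank K B = finrank K U + 1 := by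
  obtain ⟨x, hx, hxU⟩ := SetLike.not_le_iff_exists.1 fun h : H ≤ U => by
    have := Submodule.finrank_mono h
    omega
  refine ⟨U ⊔ Submodule.span K {x}, le_sup_left, sup_le hU (by simpa using hx), ?_⟩
  have h1 : U < U ⊔ Submodule.span K {x} := by
    rw [left_lt_sup]
    simpa using hxU
  have h1 := Submodule.finrank_lt_finrank_of_lt h1
  have h2 := Submodule.finrank_add_le_finrank_add_finrank U (Submodule.span K {x})
  have h3 := finrank_span_le_card (R := K) ({x} : Set V)
  simp at h3
  omega

section Step

variable [Finite K] {W H : Submodule K V} (hHW : H ≤ W)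
  (hdim : finrank K W = finrank K H + 1)
include hHW hdim

/-- `IsRepresentatives` only demands distinctness; as there are exactly `Q` extensions, distinct
ones exhaust them. -/
theorem exists_index_of_mem_extensions {k : ℕ} {U A : Submodule K V} (hU : U ≤ H)
    (hUk : finrank K U = k) {v : ℕ → V}
    (hv : IsRepresentatives W H U (Nat.card K ^ (finrank K H - k)) v)
    (hA : A ∈ extensions W H U) :
    ∃ a < Nat.card K ^ (finrank K H - k), U ⊔ Submodule.span K {v a} = A := by
  have : Finite V := Module.finite_of_finite K
  have hsub : (fun a => U ⊔ Submodule.span K {v a}) ''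
      (Set.Iio (Nat.card K ^ (finrank K H - k))) ⊆ extensions W H U := by
    rintro _ ⟨a, ha, rfl⟩
    exact sup_span_mem_extensions hHW hU (hv.1 a ha).1 (hv.1 a ha).2
  have heq := Set.eq_of_subset_of_ncard_le hsub (by
    have hinj : Set.InjOn (fun a => U ⊔ Submodule.span K {v a})
        (Set.Iio (Nat.card K ^ (finrank K H - k))) := fun a ha b hb => hv.2 a ha b hb
    rw [ncard_extensions hHW hdim hU, hUk, hinj.ncard_image]
    simp [Set.ncard_eq_toFinset_card']) (Set.toFinite _)
  rw [← heq] at hA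
  obtain ⟨a, ha, h⟩ := hA
  exact ⟨a, ha, h⟩

/-- The auxiliary sequence runs through the subspaces outside `H`, and `C'` through those inside.
Neighbours within a block share the entry `c s`; neighbours in different blocks are close by
`near_of_meets`. As `l + 1 < Q`, the insertion falls strictly inside block `i`, so both seams share
`c i`. -/
theorem IsCompleteCode.of_step {k : ℕ} (hk : k < finrank K H) {C' C'' C : List (Submodule K V)}
    (hC' : IsCompleteCode H (k + 1) C') (hC'' : IsCompleteCode H k C'')
    (hstep : Step W H (Nat.card K ^ (finrank K H - k)) C' C'' C) :
    IsCompleteCode W (k + 1) C ∧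
      C.length = C'.length + C''.length * Nat.card K ^ (finrank K H - k) := by
  obtain ⟨P', P, c', c, v, i, j, l, rfl, rfl, hrep, hch, hcl, hj, hi, hl, hij, rfl⟩ := hstep
  have hex : ∀ s < P, ∀ A ∈ extensions W H (c s), ∃ a < Nat.card K ^ (finrank K H - k),
      c s ⊔ Submodule.span K {v s a} = A := fun s hs A hA =>
    have hcs := (hC''.mem_iff (c s)).1 (by simpa using ⟨s, hs, rfl⟩)
    exists_index_of_mem_extensions hHW hdim hcs.1 hcs.2 (hrep s hs) hA
  generalize Nat.card K ^ (finrank K H - k) = Q at *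
  have hQ : 0 < Q := by omega
  have hcs : ∀ s < P, c s ≤ H ∧ finrank K (c s) = k := fun s hs =>
    (hC''.mem_iff (c s)).1 (by simpa using ⟨s, hs, rfl⟩)
  have hcinj : ∀ s < P, ∀ t < P, c s = c t → s = t := fun s hs t ht h =>
    List.inj_on_of_nodup_map hC''.nodup (by simpa using hs) (by simpa using ht) h
  have hdiv : ∀ t < P * Q, t / Q < P ∧ t % Q < Q := fun t ht =>
    ⟨Nat.div_lt_of_lt_mul (by rwa [mul_comm]), Nat.mod_lt _ hQ⟩
  rw [auxSeq_eq_map P Q hQ]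
  set g : ℕ → Submodule K V := fun t => c (t / Q) ⊔ Submodule.span K {v (t / Q) (t % Q)} with hg
  have hgext : ∀ t < P * Q, g t ∈ extensions W H (c (t / Q)) := fun t ht =>
    have h := (hrep _ (hdiv t ht).1).1 _ (hdiv t ht).2
    sup_span_mem_extensions hHW (hcs _ (hdiv t ht).1).1 h.1 h.2
  have hgmem : ∀ A, A ∈ (List.range (P * Q)).map g ↔
      A ≤ W ∧ ¬ A ≤ H ∧ finrank K A = k + 1 := by
    intro A
    rw [List.mem_map]
    constructor
    · rintro ⟨t, ht, rfl⟩
      have ht := List.mem_range.1 ht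
      refine ⟨(hgext t ht).1, (hgext t ht).2.1, ?_⟩
      rw [finrank_of_mem_extensions hHW hdim (hgext t ht), (hcs _ (hdiv t ht).1).2]
    · rintro ⟨hAW, hAH, hAk⟩
      have h1 := finrank_inf_add_one hHW hdim hAW hAH
      obtain ⟨s, hs, hs'⟩ := List.mem_map.1 ((hC''.mem_iff (A ⊓ H)).2 ⟨inf_le_right, by omega⟩)
      have hs := List.mem_range.1 hs
      obtain ⟨a, ha, rfl⟩ := hex s hs A ⟨hAW, hAH, hs'.symm⟩
      have h1 : (s * Q + a) / Q = s := by
        rw [mul_comm, Nat.mul_add_div hQ, Nat.div_eq_of_lt ha, add_zero]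
      have h2 : (s * Q + a) % Q = a := by
        rw [mul_comm, Nat.mul_add_mod, Nat.mod_eq_of_lt ha]
      refine ⟨s * Q + a, List.mem_range.2 ?_, by simp [hg, h1, h2]⟩
      calc s * Q + a < (s + 1) * Q := by rw [Nat.succ_mul]; omega
        _ ≤ P * Q := Nat.mul_le_mul_right _ hs
  have hgnodup : ((List.range (P * Q)).map g).Nodup := by
    refine List.nodup_range.map_on fun t ht t' ht' h => ?_
    have ht := List.mem_range.1 ht
    have ht' := List.mem_range.1 ht'
    have h1 := (hgext t ht).2.2
    rw [h, (hgext t' ht').2.2] at h1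
    have h2 := hcinj _ (hdiv t' ht').1 _ (hdiv t ht).1 h1
    have h3 := (hrep _ (hdiv t ht).1).2 _ (hdiv t ht).2 _ (hdiv t' ht').2
      (by simpa [hg, h2] using h)
    rw [← Nat.div_add_mod t Q, ← Nat.div_add_mod t' Q, h2, h3]
  have hcle : ∀ t, c (t / Q) ≤ g t := fun t => le_sup_left
  have hnear : ∀ t < P * Q, ∀ t' < P * Q, Near k (c (t / Q)) (c (t' / Q)) →
      (vecClass (c (t / Q)) (v (t / Q) (t % Q)) ∩
        vecClass (c (t' / Q)) (v (t' / Q) (t' % Q))).Nonempty → Near (k + 1) (g t) (g t') := by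
    intro t ht t' ht' h1 h2
    refine near_of_meets hHW hdim h1 (hgext t ht) (hgext t' ht') ?_
    exact (vecClass_inter_nonempty_iff (hcs _ (hdiv t ht).1).1 (hcs _ (hdiv t' ht').1).1
      ((hrep _ (hdiv t ht).1).1 _ (hdiv t ht).2).2).1 h2
  have hP : 0 < P := by omega
  have hgcyc : IsCyclicChain (Near (k + 1)) ((List.range (P * Q)).map g) := by
    have hccyc := hC''.cyclic
    apply isCyclicChain_map_range
    · intro t ht
      have hdt := hdiv t (by omega)
      by_cases hmod : t % Q + 1 < Q
      · have h1 : (t + 1) / Q = t / Q := by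
          rw [Nat.succ_div_of_not_dvd]
          intro h
          have := Nat.mod_eq_zero_of_dvd h
          rw [Nat.add_mod, Nat.mod_eq_of_lt (by omega : 1 < Q), Nat.mod_eq_of_lt hmod] at this
          omega
        exact near_of_le (hcs _ hdt.1).2 (hcle t) (h1 ▸ hcle (t + 1))
      · have hm : t % Q = Q - 1 := by omega
        have e : t + 1 = (t / Q + 1) * Q := by
          rw [Nat.succ_mul, mul_comm]
          have := Nat.div_add_mod t Q
          omega
        have h1 : (t + 1) / Q = t / Q + 1 := by rw [e, Nat.mul_div_cancel _ hQ]
        have h2 : (t + 1) % Q = 0 := by rw [e, Nat.mul_mod_left]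
        have h3 : t / Q + 1 < P := h1 ▸ (hdiv (t + 1) ht).1
        apply hnear t (by omega) (t + 1) ht
        · rw [h1]
          have := List.isChain_iff_getElem.1 hccyc.1 (t / Q) (by simpa using h3)
          simpa using this
        · rw [h1, h2, hm]
          exact hch _ h3
    · intro hPQ
      have e : P * Q - 1 = (P - 1) * Q + (Q - 1) := by
        obtain ⟨p, rfl⟩ := Nat.exists_eq_add_of_lt hP
        rw [zero_add, Nat.add_sub_cancel, Nat.succ_mul]
        omega
      have h1 : (P * Q - 1) / Q = P - 1 := by
        rw [e, mul_comm, Nat.mul_add_div hQ, Nat.div_eq_of_lt (by omega), add_zero]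
      have h2 : (P * Q - 1) % Q = Q - 1 := by
        rw [e, mul_comm, Nat.mul_add_mod, Nat.mod_eq_of_lt (by omega)]
      by_cases hP2 : 2 ≤ P
      · apply hnear _ (by omega) 0 hPQ
        · rw [h1, Nat.zero_div]
          have := hccyc.2 (c (P - 1))
            (by simp [List.getLast?_range, hP.ne']) (c 0)
            (by simp [List.head?_range, hP.ne'])
          exact this
        · rw [h1, h2, Nat.zero_div, Nat.zero_mod]
          exact hcl hP2
      · have hP1 : P = 1 := by omega
        refine near_of_le (hcs 0 hP).2 ?_ ?_
        · have := hcle (P * Q - 1)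
          rwa [h1, show P - 1 = 0 by omega] at this
        · simpa using hcle 0
  have hincl : c i ≤ c' j ∧ c i ≤ c' ((j + 1) % P') := by
    by_cases hP' : 2 ≤ P'
    · rw [hij hP']
      exact ⟨inf_le_left, inf_le_right⟩
    · have hP1 : P' = 1 := by omega
      subst hP1
      -- With a single entry in `C'`, any `(k + 1)`-dimensional space between `c i` and `H` must be
      -- that entry, so every `i` works.
      obtain ⟨B, h1, h2, h3⟩ := exists_finrank_succ_between (hcs i hi).1 ((hcs i hi).2.symm ▸ hk)
      have h4 := (hC'.mem_iff B).2 ⟨h2, by rw [h3, (hcs i hi).2]⟩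
      have h5 : B = c' 0 := by simpa using h4
      have hj0 : j = 0 := by omega
      subst hj0
      exact ⟨h5 ▸ h1, by simpa using h5 ▸ h1⟩
  set G := (List.range (P * Q)).map g with hG
  set x := i * Q + l + 1 with hx
  have hxlt : x < P * Q := by
    calc x < (i + 1) * Q := by rw [Nat.succ_mul]; omega
        _ ≤ P * Q := Nat.mul_le_mul_right _ hi
  have hx1 : (i * Q + l) / Q = i := by
    rw [mul_comm, Nat.mul_add_div hQ, Nat.div_eq_of_lt (by omega), add_zero]
  have hx2 : x / Q = i := by
    rw [hx, add_assoc, mul_comm, Nat.mul_add_div hQ, Nat.div_eq_of_lt (by omega), add_zero]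
  have hGlen : G.length = P * Q := by simp [hG]
  set D := ((List.range P').map c').rotate (j + 1) with hD
  have hDlen : D.length = P' := by simp [hD]
  have hDmem : ∀ A, A ∈ D ↔ A ≤ H ∧ finrank K A = k + 1 := fun A => by
    rw [hD, List.mem_rotate, hC'.mem_iff]
  have hDnodup : D.Nodup := by rw [hD, List.nodup_rotate]; exact hC'.nodup
  have hperm : (G.take x ++ D ++ G.drop x).Perm (G ++ D) := by
    calc (G.take x ++ D ++ G.drop x).Perm (G.take x ++ (G.drop x ++ D)) := by
          rw [List.append_assoc]
          exact List.perm_append_comm.append_left _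
      _ = G ++ D := by rw [← List.append_assoc, List.take_append_drop]
  refine ⟨⟨?_, ?_, ?_⟩, ?_⟩
  · rw [hperm.nodup_iff, List.nodup_append']
    refine ⟨hgnodup, hDnodup, fun A hA hA' => ?_⟩
    exact ((hgmem A).1 hA).2.1 ((hDmem A).1 hA').1
  · intro A
    rw [hperm.mem_iff, List.mem_append, hgmem, hDmem]
    constructor
    · rintro (h | h)
      · exact ⟨h.1, h.2.2⟩
      · exact ⟨h.1.trans hHW, h.2⟩
    · rintro ⟨h1, h2⟩
      by_cases h : A ≤ H
      · exact Or.inr ⟨h, h2⟩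
      · exact Or.inl ⟨h1, h, h2⟩
  · apply IsCyclicChain.insert
    · rwa [List.take_append_drop]
    · exact (hC'.cyclic.rotate (by simpa using hj)).1
    · exact List.ne_nil_of_length_pos (by rw [List.length_take]; omega)
    · exact List.ne_nil_of_length_pos (by rw [List.length_drop]; omega)
    · exact List.ne_nil_of_length_pos (by omega)
    · intro A hA B hB
      rw [hx, List.take_add_one, List.getLast?_append] at hA
      have hA' : A = g (i * Q + l) := by
        simp only [hG, List.getElem?_map, List.getElem?_range (show i * Q + l < P * Q by omega)] at hA
        simpa using hA.symm
      have hB' : B = c' ((j + 1) % P') := by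
        rw [List.head?_eq_getElem?, hD, List.getElem?_rotate (by simp; omega)] at hB
        simp only [List.getElem?_map, List.length_map, List.length_range, zero_add,
          List.getElem?_range (Nat.mod_lt (j + 1) (by omega : 0 < P'))] at hB
        simpa using hB.symm
      subst hA' hB'
      exact near_of_le (hcs i hi).2 (by simpa [hx1] using hcle (i * Q + l)) hincl.2
    · intro A hA B hB
      have hA' : A = c' j := by
        have e : (P' - 1 + (j + 1)) % P' = j := by
          rw [show P' - 1 + (j + 1) = P' + j by omega, Nat.add_mod_left, Nat.mod_eq_of_lt hj]
        rw [List.getLast?_eq_getElem?, hDlen, hD, List.getElem?_rotate (by simp; omega)] at hA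
        simp only [List.getElem?_map, List.length_map, List.length_range, e,
          List.getElem?_range hj] at hA
        simpa using hA.symm
      have hB' : B = g x := by
        rw [List.head?_drop, hG, List.getElem?_map, List.getElem?_range hxlt] at hB
        simpa using hB.symm
      subst hA' hB'
      exact near_of_le (hcs i hi).2 hincl.1 (by simpa [hx2] using hcle x)
  · rw [hperm.length_eq, List.length_append, hGlen, hDlen]
    simp [add_comm]

end Step

theorem isCompleteCode_of_produced [Finite K] {N : ℕ} {W : ℕ → Submodule K V} (hW : Monotone W)
    (hdim : ∀ m ≤ N, finrank K (W m) = m) {m k : ℕ} {C : List (Submodule K V)}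
    (h : Produced W m k C) : m ≤ N →
      k ≤ m ∧ IsCompleteCode (W m) k C ∧ C.length = gaussianCoeff (Nat.card K) m k := by
  induction h with
  | zero m =>
    refine fun _ => ⟨Nat.zero_le _, ⟨by simp, fun A => ?_, ?_⟩, by simp [gaussianCoeff_zero]⟩
    · simp only [List.mem_singleton, Submodule.finrank_eq_zero]
      exact ⟨fun h => ⟨h ▸ bot_le, h⟩, fun h => h.2⟩
    · exact ⟨List.IsChain.singleton _, by simp [Near]⟩
  | full m =>
    refine fun hm => ⟨le_rfl, ⟨by simp, fun A => ?_, ?_⟩, by simp [gaussianCoeff_self]⟩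
    · rw [List.mem_singleton]
      refine ⟨fun h => ⟨h.le, h ▸ hdim m hm⟩, fun h => ?_⟩
      exact Submodule.eq_of_le_of_finrank_eq h.1 (h.2.trans (hdim m hm).symm)
    · refine ⟨List.IsChain.singleton _, fun a ha b hb => ?_⟩
      obtain rfl : W m = a := by simpa using ha
      obtain rfl : W m = b := by simpa using hb
      rw [Near, inf_idem, hdim m hm]
      exact Nat.le_succ m
  | step m k hk C' C'' C _ _ hstep ih' ih'' =>
    intro hm
    have h1 := ih' (by omega)
    have h2 := ih'' (by omega)
    have hH := hdim m (by omega)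
    have hd : finrank K (W (m + 1)) = finrank K (W m) + 1 := by rw [hH, hdim _ hm]
    have := IsCompleteCode.of_step (hW (Nat.le_succ m)) hd (by rwa [hH]) h1.2.1 h2.2.1
      (by rwa [hH])
    refine ⟨by omega, this.1, ?_⟩
    rw [this.2, h1.2.2, h2.2.2, hH, gaussianCoeff_succ_succ _ _ _ hk]

end GrassmannGray

/-! ### Decoding the output of a step -/

theorem List.eq_map_range_getD {β : Type*} (l : List β) (d : β) {n : ℕ} (h : l.length = n) :
    l = (List.range n).map fun t => l.getD t d := by
  refine List.ext_getElem (by simpa using h) fun i h1 h2 => ?_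
  simp [List.getElem?_eq_getElem h1]

theorem List.flatMap_replicate_injective {β : Type*} {n : ℕ} (hn : 0 < n) :
    Function.Injective fun l : List β => l.flatMap (List.replicate n) := by
  intro l
  induction l with
  | nil =>
    rintro (_ | ⟨b, l'⟩) h
    · rfl
    · have := congrArg List.length h
      simp at this
      omega
  | cons a l ih =>
    rintro (_ | ⟨b, l'⟩) h
    · have := congrArg List.length h
      simp at this
      omega
    · simp only [List.flatMap_cons] at h
      obtain ⟨h1, h2⟩ := List.append_inj h (by simp)
      rw [ih h2, (List.replicate_right_inj hn.ne').1 h1]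

theorem List.takeWhile_take_append_append_drop {β : Type*} (p : β → Bool) {l m : List β}
    (hl : ∀ a ∈ l, p a = true) (hm : ∀ a ∈ m, p a = false) (hm0 : m ≠ []) (x : ℕ) :
    (l.take x ++ m ++ l.drop x).takeWhile p = l.take x := by
  rw [List.append_assoc, List.takeWhile_append_of_pos fun a ha => hl a (List.mem_of_mem_take ha)]
  obtain ⟨d, m, rfl⟩ := List.exists_cons_of_ne_nil hm0
  simp [hm d (by simp)]

theorem List.filter_take_append_append_drop {β : Type*} (p : β → Bool) {l m : List β}
    (hl : ∀ a ∈ l, p a = true) (hm : ∀ a ∈ m, p a = false) (x : ℕ) :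
    (l.take x ++ m ++ l.drop x).filter p = l := by
  rw [List.filter_append, List.filter_append,
    List.filter_eq_self.2 fun a ha => hl a (List.mem_of_mem_take ha),
    List.filter_eq_self.2 fun a ha => hl a (List.mem_of_mem_drop ha),
    List.filter_eq_nil_iff.2 fun a ha => by simp [hm a ha], List.append_nil,
    List.take_append_drop]

theorem List.filter_not_take_append_append_drop {β : Type*} (p : β → Bool) {l m : List β}
    (hl : ∀ a ∈ l, p a = true) (hm : ∀ a ∈ m, p a = false) (x : ℕ) :
    (l.take x ++ m ++ l.drop x).filter (fun a => !p a) = m := by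
  rw [List.filter_append, List.filter_append,
    List.filter_eq_nil_iff.2 fun a ha => by simp [hl a (List.mem_of_mem_take ha)],
    List.filter_eq_self.2 fun a ha => by simp [hm a ha],
    List.filter_eq_nil_iff.2 fun a ha => by simp [hl a (List.mem_of_mem_drop ha)],
    List.append_nil, List.nil_append]

/-- The block lengths are prescribed by `Xs`, so concatenation loses no information. -/
theorem IsBlockListing.eq_of_flatten_eq {α : Type*} {L L' : List (List α)} {Xs : List (Finset α)}
    (h : IsBlockListing L Xs) (h' : IsBlockListing L' Xs) (he : L.flatten = L'.flatten) :
    L = L' := by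
  have key : ∀ {L : List (List α)}, IsBlockListing L Xs →
      L.map List.length = Xs.map Finset.card := by
    intro L h
    clear * - h
    induction h with
    | nil => rfl
    | cons h _ ih => simp [h.length_eq, ih]
  rw [List.eq_iff_flatten_eq, key h, key h']
  exact ⟨he, rfl⟩

theorem IsBlockListing.mem_flatten {α : Type*} {L : List (List α)} {Xs : List (Finset α)}
    (h : IsBlockListing L Xs) {x : α} (hx : x ∈ L.flatten) : ∃ X ∈ Xs, x ∈ X := by
  induction h with
  | nil => simp at hx
  | @cons l X _ _ h _ ih =>
    rw [List.flatten_cons, List.mem_append] at hx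
    rcases hx with hx | hx
    · exact ⟨X, by simp, by rwa [h.mem_iff, Finset.mem_toList] at hx⟩
    · obtain ⟨Y, hY, hxY⟩ := ih hx
      exact ⟨Y, List.mem_cons_of_mem _ hY, hxY⟩

/-! ### Counting the outputs of one step -/

namespace GrassmannGray

variable {K V : Type*} [Field K] [AddCommGroup V] [Module K V] [FiniteDimensional K V] [Finite K]

/-- The finite set of subspaces of `W`, not contained in `H`, that meet `H` in `U`. -/
noncomputable def extensionFinset (W H U : Submodule K V) : Finset (Submodule K V) :=
  haveI : Finite V := Module.finite_of_finite K
  (extensions W H U).toFinite.toFinset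

theorem mem_extensionFinset {W H U A : Submodule K V} :
    A ∈ extensionFinset W H U ↔ A ∈ extensions W H U := by
  simp [extensionFinset]

section Hyperplane

variable {W H : Submodule K V} (hHW : H ≤ W) (hdim : finrank K W = finrank K H + 1)
include hHW hdim

theorem card_extensionFinset {k : ℕ} {U : Submodule K V} (hU : U ≤ H) (hUk : finrank K U = k) :
    (extensionFinset W H U).card = Nat.card K ^ (finrank K H - k) := by
  rw [← hUk, ← ncard_extensions hHW hdim hU, ← Set.ncard_coe_finset]
  congr 1
  ext A
  simp [mem_extensionFinset]

theorem extensionFinset_nonempty {U : Submodule K V} (hU : U ≤ H) :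
    (extensionFinset W H U).Nonempty := by
  rw [← Finset.card_pos, card_extensionFinset hHW hdim hU rfl]
  exact pow_pos Nat.card_pos _

theorem map_inf_flatten {k : ℕ} {L : List (List (Submodule K V))} {C : List (Submodule K V)}
    (hC : ∀ U ∈ C, U ≤ H ∧ finrank K U = k)
    (hL : IsBlockListing L (C.map (extensionFinset W H))) :
    L.flatten.map (· ⊓ H) = C.flatMap (List.replicate (Nat.card K ^ (finrank K H - k))) := by
  induction C generalizing L with
  | nil =>
    cases hL
    rfl
  | cons U C ih =>
    obtain _ | ⟨h, h'⟩ := hL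
    rw [List.flatten_cons, List.map_append, List.flatMap_cons,
      ih (fun U hU => hC U (List.mem_cons_of_mem _ hU)) h']
    congr 1
    obtain ⟨hU, hUk⟩ := hC U (by simp)
    rw [List.eq_replicate_iff, List.length_map, h.length_eq, Finset.length_toList,
      card_extensionFinset hHW hdim hU hUk]
    refine ⟨rfl, fun B hB => ?_⟩
    obtain ⟨A, hA, rfl⟩ := List.mem_map.1 hB
    rw [h.mem_iff, Finset.mem_toList, mem_extensionFinset] at hA
    exact hA.2.2

omit [Finite K] in
theorem exists_sup_span_eq {U A : Submodule K V} (hA : A ∈ extensions W H U) :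
    ∃ v, v ∈ W ∧ v ∉ H ∧ U ⊔ Submodule.span K {v} = A := by
  obtain ⟨v, hv, hvH⟩ := exists_mem_notMem_of_mem_extensions hA
  exact ⟨v, hA.1 hv, hvH, (eq_sup_span_of_mem_extensions hHW hdim hA hv hvH).symm⟩

/-- Translates listings of subspaces back into the construction's vectors: any vector of an
extension outside `H` represents its class. The choice `j = P' - 1` makes the rotation trivial. -/
theorem step_of_blockListing {k : ℕ} {C' C'' : List (Submodule K V)}
    (hC'0 : 0 < C'.length) (hC'' : ∀ U ∈ C'', U ≤ H ∧ finrank K U = k)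
    {L : List (List (Submodule K V))}
    (hL : IsBlockListing L (C''.map (extensionFinset W H)))
    (hcyc : 2 ≤ C''.length → IsCyclicChain (Joins fun A B => ¬ A ⊓ B ≤ H) L) {i l : ℕ}
    (hi : i < C''.length)
    (hi' : 2 ≤ C'.length → C''.getD i ⊥ = C'.getD (C'.length - 1) ⊥ ⊓ C'.getD 0 ⊥)
    (hl : l + 1 < Nat.card K ^ (finrank K H - k)) :
    Step W H (Nat.card K ^ (finrank K H - k)) C' C''
      (L.flatten.take (i * Nat.card K ^ (finrank K H - k) + l + 1) ++ C' ++
        L.flatten.drop (i * Nat.card K ^ (finrank K H - k) + l + 1)) := by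
  have hlen : L.length = C''.length := by simpa using hL.length_eq
  have hblock : ∀ s < C''.length, (L.getD s []).Perm (extensionFinset W H (C''.getD s ⊥)).toList := by
    intro s hs
    have := List.Forall₂.get hL (i := s) (by omega) (by simpa using hs)
    simpa [List.getElem?_eq_getElem, hs, hlen] using this
  have hcard : ∀ s < C''.length, (L.getD s []).length = Nat.card K ^ (finrank K H - k) := by
    intro s hs
    have hmem : C''.getD s ⊥ ∈ C'' := by
      rw [List.getD_eq_getElem _ _ hs]
      exact List.getElem_mem _
    rw [(hblock s hs).length_eq, Finset.length_toList,
      card_extensionFinset hHW hdim (hC'' _ hmem).1 (hC'' _ hmem).2]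
  have hcH : ∀ s < C''.length, C''.getD s ⊥ ≤ H := by
    intro s hs
    rw [List.getD_eq_getElem _ _ hs]
    exact (hC'' _ (List.getElem_mem _)).1
  generalize Nat.card K ^ (finrank K H - k) = Q at *
  have hnodup : ∀ s < C''.length, (L.getD s []).Nodup := fun s hs =>
    (hblock s hs).nodup_iff.2 (Finset.nodup_toList _)
  have hv : ∀ s a, ∃ v, s < C''.length → a < Q → v ∈ W ∧ v ∉ H ∧
      C''.getD s ⊥ ⊔ Submodule.span K {v} = (L.getD s []).getD a ⊥ := by
    intro s a
    by_cases h : s < C''.length ∧ a < Q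
    · have hmem : (L.getD s []).getD a ⊥ ∈ extensions W H (C''.getD s ⊥) := by
        have h1 : a < (L.getD s []).length := by rw [hcard s h.1]; exact h.2
        rw [← mem_extensionFinset, ← Finset.mem_toList, ← (hblock s h.1).mem_iff,
          List.getD_eq_getElem _ _ h1]
        exact List.getElem_mem _
      obtain ⟨v, hv⟩ := exists_sup_span_eq hHW hdim hmem
      exact ⟨v, fun _ _ => hv⟩
    · exact ⟨0, fun h1 h2 => absurd ⟨h1, h2⟩ h⟩
  choose v hv using hv
  have haux : auxSeq C''.length Q (fun s => C''.getD s ⊥) v = L.flatten := by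
    rw [auxSeq, List.flatMap_def]
    congr 1
    conv_rhs => rw [List.eq_map_range_getD L [] hlen]
    refine List.map_congr_left fun s hs => ?_
    have hs := List.mem_range.1 hs
    conv_rhs => rw [List.eq_map_range_getD (L.getD s []) ⊥ (hcard s hs)]
    exact List.map_congr_left fun a ha => (hv s a hs (List.mem_range.1 ha)).2.2
  have hjoin : ∀ s < C''.length, ∀ t < C''.length,
      Joins (fun A B : Submodule K V => ¬ A ⊓ B ≤ H) (L.getD s []) (L.getD t []) →
      (vecClass (C''.getD s ⊥) (v s (Q - 1)) ∩ vecClass (C''.getD t ⊥) (v t 0)).Nonempty := by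
    rintro s hs t ht ⟨A, hA, B, hB, hAB⟩
    have hvs := hv s (Q - 1) hs (by omega)
    have hvt := hv t 0 ht (by omega)
    rw [vecClass_inter_nonempty_iff (hcH s hs) (hcH t ht) hvs.2.1, hvs.2.2, hvt.2.2]
    rw [List.getLast?_eq_getElem?, hcard s hs] at hA
    rw [List.head?_eq_getElem?] at hB
    rwa [List.getD_eq_getElem?_getD (l := L.getD s []), hA,
      List.getD_eq_getElem?_getD (l := L.getD t []), hB]
  refine ⟨C'.length, C''.length, fun s => C'.getD s ⊥, fun s => C''.getD s ⊥, v, i, C'.length - 1,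
    l, List.eq_map_range_getD _ _ rfl, List.eq_map_range_getD _ _ rfl, ?_, ?_, ?_, by omega, hi,
    hl, ?_, ?_⟩
  · refine fun s hs => ⟨fun a ha => ⟨(hv s a hs ha).1, (hv s a hs ha).2.1⟩, ?_⟩
    intro a ha b hb hab
    simp only [(hv s a hs ha).2.2, (hv s b hs hb).2.2] at hab
    have ha' : a < (L.getD s []).length := by rwa [hcard s hs]
    have hb' : b < (L.getD s []).length := by rwa [hcard s hs]
    rw [List.getD_eq_getElem _ _ ha', List.getD_eq_getElem _ _ hb'] at hab
    exact (hnodup s hs).getElem_inj_iff.1 hab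
  · intro s hs
    refine hjoin s (by omega) (s + 1) hs ?_
    have := List.isChain_iff_getElem.1 (hcyc (by omega)).1 s (by omega)
    rwa [List.getD_eq_getElem _ _ (by omega), List.getD_eq_getElem _ _ (by omega)]
  · intro h2
    refine hjoin _ (by omega) 0 (by omega) ?_
    refine (hcyc h2).2 _ ?_ _ ?_
    · rw [List.getLast?_eq_getElem?, hlen, List.getD_eq_getElem _ _ (by omega)]
      exact List.getElem?_eq_getElem _
    · rw [List.head?_eq_getElem?, List.getD_eq_getElem _ _ (by omega)]
      exact List.getElem?_eq_getElem _
  · intro h2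
    simp only
    rw [hi' h2, Nat.sub_add_cancel hC'0, Nat.mod_self]
  · rw [haux, Nat.sub_add_cancel hC'0, List.rotate_length]

omit [Finite K] hHW hdim in
theorem IsCompleteCode.length_pos {k : ℕ} (hk : k ≤ finrank K H) {C : List (Submodule K V)}
    (hC : IsCompleteCode H k C) : 0 < C.length := by
  have key : ∀ r ≤ finrank K H, ∃ U ≤ H, finrank K U = r := by
    intro r hr
    induction r with
    | zero => exact ⟨⊥, bot_le, finrank_bot K V⟩
    | succ r ih =>
      obtain ⟨U, hU, hUr⟩ := ih (by omega)
      obtain ⟨B, -, hB, hBr⟩ := exists_finrank_succ_between hU (by omega)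
      exact ⟨B, hB, by omega⟩
  obtain ⟨U, hU⟩ := key k hk
  exact List.length_pos_of_mem ((hC.mem_iff U).2 hU)

omit [Finite K] hHW hdim in
theorem exists_index_insertion {k : ℕ} {C' C'' : List (Submodule K V)}
    (hC' : IsCompleteCode H (k + 1) C') (hC'' : IsCompleteCode H k C'') (hpos : 0 < C''.length) :
    ∃ i < C''.length,
      2 ≤ C'.length → C''.getD i ⊥ = C'.getD (C'.length - 1) ⊥ ⊓ C'.getD 0 ⊥ := by
  by_cases h2 : 2 ≤ C'.length
  · rw [List.getD_eq_getElem _ _ (by omega : C'.length - 1 < C'.length),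
      List.getD_eq_getElem _ _ (by omega : 0 < C'.length)]
    have h3 := hC'.cyclic.2 C'[C'.length - 1]
      (by rw [List.getLast?_eq_getElem?]; exact List.getElem?_eq_getElem _) C'[0]
      (by rw [List.head?_eq_getElem?]; exact List.getElem?_eq_getElem _)
    have h4 := (hC'.mem_iff C'[C'.length - 1]).1 (List.getElem_mem _)
    have h5 := (hC'.mem_iff C'[0]).1 (List.getElem_mem _)
    have h6 := adj_of_near h4.2 h5.2 (fun h => by
      have := hC'.nodup.getElem_inj_iff.1 h
      omega) h3
    -- The last and first entries of the cyclic code `C'` meet in dimension `k`, and the complete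
    -- code `C''` contains their intersection.
    obtain ⟨i, hi, h⟩ := List.mem_iff_getElem.1
      ((hC''.mem_iff (C'[C'.length - 1] ⊓ C'[0])).2 ⟨inf_le_left.trans h4.1, by simpa [Adj] using h6⟩)
    exact ⟨i, hi, fun _ => by rw [List.getD_eq_getElem _ _ hi, h]⟩
  · exact ⟨0, hpos, fun h => absurd h h2⟩

open Classical in
open scoped Nat in
theorem exists_step_codes {k : ℕ} (hk : k < finrank K H) {C' C'' : List (Submodule K V)}
    (hC' : IsCompleteCode H (k + 1) C') (hC'' : IsCompleteCode H k C'')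
    (hC'0 : 0 < C'.length) (hC''0 : 0 < C''.length) :
    ∃ F : Finset (List (Submodule K V)),
      (∀ C ∈ F, Step W H (Nat.card K ^ (finrank K H - k)) C' C'' C ∧
        C.filter (fun A => !decide (¬ A ≤ H)) = C' ∧
        (C.filter (fun A => decide (¬ A ≤ H))).map (· ⊓ H) =
          C''.flatMap (List.replicate (Nat.card K ^ (finrank K H - k)))) ∧
      (Nat.card K - 1) * Nat.card K ^ (finrank K H - k - 1) *
        ((Nat.card K ^ (finrank K H - k) - 1)! * Nat.card K) ^ C''.length ≤ F.card := by
  have hmem'' : ∀ U ∈ C'', U ≤ H ∧ finrank K U = k := fun U hU => (hC''.mem_iff U).1 hU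
  have hR : ∀ X ∈ C''.map (extensionFinset W H), ∀ Y ∈ C''.map (extensionFinset W H), X ≠ Y →
      ∀ A ∈ X, Nat.card K ≤ {B ∈ Y | ¬ A ⊓ B ≤ H}.card := by
    intro X hX Y hY hXY A hA
    obtain ⟨U, hU, rfl⟩ := List.mem_map.1 hX
    obtain ⟨U', hU', rfl⟩ := List.mem_map.1 hY
    have h1 : ¬ U ≤ U' := fun h => hXY (by
      rw [Submodule.eq_of_le_of_finrank_eq h ((hmem'' U hU).2.trans (hmem'' U' hU').2.symm)])
    refine (card_le_ncard_meeting_extensions hHW (hmem'' U' hU').1 h1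
      (mem_extensionFinset.1 hA)).trans (le_of_eq ?_)
    rw [← Set.ncard_coe_finset]
    congr 1
    ext B
    simp [mem_extensionFinset]
  obtain ⟨G, hG, hGc⟩ := exists_cyclic_blockListings (fun A B : Submodule K V => ¬ A ⊓ B ≤ H)
    (Nat.card K) (finrank K H - k) Finite.one_lt_card (by omega)
    (C''.map (extensionFinset W H)) (by simpa using List.ne_nil_of_length_pos hC''0)
    (hC''.nodup.map_on fun U hU U' hU' h => by
      obtain ⟨A, hA⟩ := extensionFinset_nonempty hHW hdim (hmem'' U hU).1
      have hA' := hA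
      rw [h] at hA'
      rw [← (mem_extensionFinset.1 hA).2.2, (mem_extensionFinset.1 hA').2.2])
    (fun X hX => by
      obtain ⟨U, hU, rfl⟩ := List.mem_map.1 hX
      exact card_extensionFinset hHW hdim (hmem'' U hU).1 (hmem'' U hU).2)
    (fun X hX Y hY hXY A hA => by convert hR X hX Y hY hXY A hA)
    (fun X hX Y hY hXY A hA => by
      -- The meeting relation is symmetric, so the bound for heads serves for last entries too.
      simp only [inf_comm _ A]
      convert hR X hX Y hY hXY A hA)
  rw [List.length_map] at hGc
  obtain ⟨i, hi, hi'⟩ := exists_index_insertion hC' hC'' hC''0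
  have hout : ∀ L ∈ G, ∀ A ∈ L.flatten, decide (¬ A ≤ H) = true := by
    intro L hL A hA
    obtain ⟨X, hX, hAX⟩ := (hG L hL).1.mem_flatten hA
    obtain ⟨U, hU, rfl⟩ := List.mem_map.1 hX
    simpa using (mem_extensionFinset.1 hAX).2.1
  have hin : ∀ A ∈ C', decide (¬ A ≤ H) = false := by
    intro A hA
    simpa using ((hC'.mem_iff A).1 hA).1
  have hflen : ∀ L ∈ G, L.flatten.length = C''.length * Nat.card K ^ (finrank K H - k) := by
    intro L hL
    have := congrArg List.length (map_inf_flatten hHW hdim hmem'' (hG L hL).1)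
    rw [List.length_map] at this
    rw [this]
    simp
  obtain ⟨F, hF, hFc⟩ := exists_finset_of_fibers G
    (fun _ l => l + 1 < Nat.card K ^ (finrank K H - k)) (Nat.card K ^ (finrank K H - k) - 1)
    (fun _ _ => ⟨Finset.range (Nat.card K ^ (finrank K H - k) - 1),
      fun l hl => by have := Finset.mem_range.1 hl; omega, by simp⟩)
    (fun L l => L.flatten.take (i * Nat.card K ^ (finrank K H - k) + l + 1) ++ C' ++
        L.flatten.drop (i * Nat.card K ^ (finrank K H - k) + l + 1))
    (by
      intro L hL L' hL' l l' hl hl' h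
      -- The entries outside `H` determine the listing; the length of the initial run outside `H`
      -- then determines `ℓ`.
      have h1 := congrArg (List.filter (fun A => decide (¬ A ≤ H))) h
      rw [List.filter_take_append_append_drop _ (hout L hL) hin,
        List.filter_take_append_append_drop _ (hout L' hL') hin] at h1
      have hLL' := (hG L hL).1.eq_of_flatten_eq (hG L' hL').1 h1
      subst hLL'
      refine ⟨rfl, ?_⟩
      have h2 := congrArg (List.takeWhile (fun A => decide (¬ A ≤ H))) h
      have hne := List.ne_nil_of_length_pos hC'0
      rw [List.takeWhile_take_append_append_drop _ (hout L hL) hin hne,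
        List.takeWhile_take_append_append_drop _ (hout L hL) hin hne] at h2
      have h3 := congrArg List.length h2
      rw [List.length_take, List.length_take, hflen L hL] at h3
      have h4 : (i + 1) * Nat.card K ^ (finrank K H - k) ≤
          C''.length * Nat.card K ^ (finrank K H - k) := Nat.mul_le_mul_right _ hi
      rw [Nat.succ_mul] at h4
      omega)
  refine ⟨F, fun C hC => ?_, hGc.trans hFc⟩
  obtain ⟨L, hL, l, hl, rfl⟩ := hF C hC
  refine ⟨step_of_blockListing hHW hdim hC'0 hmem'' (hG L hL).1
    (fun h => (hG L hL).2 (by simpa using h)) hi hi' hl, ?_, ?_⟩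
  · exact List.filter_not_take_append_append_drop _ (hout L hL) hin _
  · rw [List.filter_take_append_append_drop _ (hout L hL) hin]
    exact map_inf_flatten hHW hdim hmem'' (hG L hL).1

end Hyperplane

theorem finite_codes (W : ℕ → Submodule K V) (n k : ℕ) :
    {C : List (Submodule K V) | IsGrayCode (W n) k C ∧ Produced W n k C}.Finite := by
  have : Finite V := Module.finite_of_finite K
  have := Fintype.ofFinite (Submodule K V)
  have h : {C : List (Submodule K V) | C.Nodup}.Finite :=
    Finite.of_fintype { C : List (Submodule K V) // C.Nodup }
  exact h.subset fun C hC => hC.1.nodup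

/-! ### The recursion along the flag -/

section Flag

variable {N : ℕ} {W : ℕ → Submodule K V} (hW : Monotone W)
  (hdim : ∀ m ≤ N, finrank K (W m) = m)
include hW hdim

open scoped Nat in
theorem numCodes_mul_le {m k : ℕ} (hm : m + 1 ≤ N) (hk : k < m) :
    numCodes W m k * numCodes W m (k + 1) *
        ((Nat.card K - 1) * Nat.card K ^ (m - k - 1) *
          ((Nat.card K ^ (m - k) - 1)! * Nat.card K) ^ gaussianCoeff (Nat.card K) m k) ≤
      numCodes W (m + 1) (k + 1) := by
  classical
  have hH := hdim m (by omega)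
  have hd : finrank K (W (m + 1)) = finrank K (W m) + 1 := by rw [hH, hdim _ hm]
  obtain ⟨F, hF, hFc⟩ := exists_finset_of_fibers
    ((finite_codes W m k).toFinset ×ˢ (finite_codes W m (k + 1)).toFinset)
    (fun p C => Produced W (m + 1) (k + 1) C ∧ C.filter (fun A => !decide (¬ A ≤ W m)) = p.2 ∧
        (C.filter (fun A => decide (¬ A ≤ W m))).map (· ⊓ W m) =
          p.1.flatMap (List.replicate (Nat.card K ^ (m - k))))
    ((Nat.card K - 1) * Nat.card K ^ (m - k - 1) *
          ((Nat.card K ^ (m - k) - 1)! * Nat.card K) ^ gaussianCoeff (Nat.card K) m k)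
    (by
      rintro ⟨C'', C'⟩ hp
      simp only [Finset.mem_product, Set.Finite.mem_toFinset, Set.mem_ofPred_eq] at hp
      have h' := isCompleteCode_of_produced hW hdim hp.2.2 (by omega)
      have h'' := isCompleteCode_of_produced hW hdim hp.1.2 (by omega)
      obtain ⟨F, hF, hFc⟩ := exists_step_codes (hW (Nat.le_succ m)) hd (by rwa [hH])
        h'.2.1 h''.2.1 (h'.2.1.length_pos (by omega)) (h''.2.1.length_pos (by omega))
      rw [hH, h''.2.2] at hFc
      rw [hH] at hF
      exact ⟨F, fun C hC => ⟨Produced.step m k hk C' C'' C hp.2.2 hp.1.2 (hF C hC).1,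
        (hF C hC).2⟩, hFc⟩)
    (fun _ C => C)
    (by
      -- Outputs from different pairs differ: the part of the code inside `W m` is `C'`, and the
      -- traces of the rest determine `C''`.
      rintro ⟨C₁'', C₁'⟩ - ⟨C₂'', C₂'⟩ - C _ ⟨-, h1, h2⟩ ⟨-, h3, h4⟩ rfl
      refine ⟨Prod.ext ?_ (h1.symm.trans h3), rfl⟩
      exact List.flatMap_replicate_injective (pow_pos Nat.card_pos _) (h2.symm.trans h4))
  rw [Finset.card_product, ← Set.ncard_eq_toFinset_card _ (finite_codes W m k),
    ← Set.ncard_eq_toFinset_card _ (finite_codes W m (k + 1))] at hFc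
  refine hFc.trans ?_
  rw [numCodes, ← Set.ncard_coe_finset]
  refine Set.ncard_le_ncard (fun C hC => ?_) (finite_codes W _ _)
  obtain ⟨p, -, C, ⟨hprod, -⟩, rfl⟩ := hF _ hC
  exact ⟨(isCompleteCode_of_produced hW hdim hprod hm).2.1.isGrayCode, hprod⟩

theorem one_le_numCodes_of_produced {m k : ℕ} (hm : m ≤ N) {C : List (Submodule K V)}
    (hC : Produced W m k C) : 1 ≤ numCodes W m k :=
  (Set.ncard_pos (finite_codes W m k)).2
    ⟨C, (isCompleteCode_of_produced hW hdim hC hm).2.1.isGrayCode, hC⟩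

/-- Double induction with `a = n - k` and `b = k`: the codes `C''` and `C'` of a step have
parameters `(a + 1, b)` and `(a, b + 1)`, the two smaller products of `prod_pow_choose_succ_succ`,
and the step's own factor is the corner. -/
theorem prod_le_numCodes (a b : ℕ) (hab : a + b ≤ N) :
    (∏ i ∈ Finset.Icc 1 a, ∏ j ∈ Finset.Icc 1 b,
        ((Nat.card K - 1) * Nat.card K ^ (i - 1) *
          ((Nat.card K ^ i - 1).factorial * Nat.card K) ^
            gaussianCoeff (Nat.card K) (i + j - 1) (j - 1)) ^ (a + b - i - j).choose (a - i)) ≤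
      numCodes W (a + b) b := by
  induction a generalizing b with
  | zero => simpa using one_le_numCodes_of_produced hW hdim (by omega) (Produced.full b)
  | succ a iha =>
    induction b with
    | zero => simpa using one_le_numCodes_of_produced hW hdim hab (Produced.zero (a + 1))
    | succ b ihb =>
      have h1 := iha (b + 1) (by omega)
      have h2 := ihb (by omega)
      have h3 := numCodes_mul_le hW hdim (m := a + 1 + b) (k := b) (by omega) (by omega)
      rw [prod_pow_choose_succ_succ (fun i j => (Nat.card K - 1) * Nat.card K ^ (i - 1) *
          ((Nat.card K ^ i - 1).factorial * Nat.card K) ^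
            gaussianCoeff (Nat.card K) (i + j - 1) (j - 1))]
      refine le_trans ?_ h3
      rw [show a + 1 + b - b = a + 1 by omega, show a + 1 + (b + 1) - 1 = a + 1 + b by omega,
        Nat.add_sub_cancel]
      rw [show a + (b + 1) = a + 1 + b by ring] at h1
      rw [show a + (b + 1) = a + 1 + b by ring]
      exact Nat.mul_le_mul_right _ (Nat.mul_le_mul h2 h1)

end Flag

end GrassmannGray

theorem mainTheorem7 {K V : Type*} [Field K] [Finite K] [AddCommGroup V] [Module K V]
    [FiniteDimensional K V] (q n k : ℕ) (hq : Nat.card K = q) (hV : Module.finrank K V = n)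
    (hkn : k ≤ n) (W : ℕ → Submodule K V) (hW : Monotone W)
    (hdim : ∀ m ≤ n, Module.finrank K (W m) = m) :
    (∏ i ∈ Finset.Icc 1 (n - k), ∏ j ∈ Finset.Icc 1 k,
        ((q - 1) * q ^ (i - 1) *
          ((q ^ i - 1).factorial * q) ^ gaussianCoeff q (i + j - 1) (j - 1)) ^
            (n - i - j).choose (n - k - i)
      ≤ GrassmannGray.numCodes W n k) ∧
    (0 < k → k < n →
      GrassmannGray.numCodes W (n - 1) (k - 1) * GrassmannGray.numCodes W (n - 1) k *
          ((q - 1) * q ^ (n - k - 1) *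
            ((q ^ (n - k) - 1).factorial * q) ^ gaussianCoeff q (n - 1) (k - 1))
        ≤ GrassmannGray.numCodes W n k) := by
  subst hq
  constructor
  · have h := GrassmannGray.prod_le_numCodes hW hdim (n - k) k (by omega)
    rwa [Nat.sub_add_cancel hkn] at h
  · intro h0 hlt
    obtain ⟨m, rfl⟩ : ∃ m, n = m + 1 := ⟨n - 1, by omega⟩
    obtain ⟨k, rfl⟩ : ∃ k', k = k' + 1 := ⟨k - 1, by omega⟩
    have h := GrassmannGray.numCodes_mul_le hW hdim le_rfl (by omega : k < m)
    simpa only [Nat.add_sub_cancel, Nat.add_sub_add_right] using h
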